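/- Let $U\subset\mathbb{R}^2$ be a nonempty bounded open set (for instance a subdomain $\Omega_j$ of a domain decomposition), let $a,c:U\to\mathbb{R}$ be measurable with $0<a_{\min}\le a\le a_{\max}$ and $0<c_{\min}\le c\le c_{\max}$ almost everywhere on $U$, let $\omega>0$ and $\kappa=\omega/c$. For complex-valued $u,v\in H^1(U)$ put $$\mathcal A(u,v)=\int_U a\,\nabla u\cdot\nabla\overline v\,dx,\qquad (\kappa^2u,v)_U=\int_U\kappa^2u\,\overline v\,dx,\qquad h(u,v)=\mathcal A(u,v)-(\kappa^2u,v)_U,$$ $$\|u\|^2=\mathcal A(u,u)+(\kappa^2u,u)_U .$$ Let $H^1_0(U)$ be the closure of $C_c^\infty(U)$ in $H^1(U)$. Let $\Lambda$ be the set of all local Dirichlet eigenvalues, i.e. of all $\lambda\in\mathbb{R}$ for which there is $0\ne b\in H^1_0(U)$ with $\mathcal A(b,v)=\lambda(\kappa^2b,v)_U$ for all $v\in H^1_0(U)$. Assume that $1\notin\Lambda$ and put $$\beta=\inf_{\lambda\in\Lambda}\frac{|\lambda-1|}{\lambda+1}.$$ Then: 1. $\beta>0$, and $$\inf_{0\ne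 u\in H^1_0(U)}\ \sup_{0\ne v\in H^1_0(U)}\frac{|h(u,v)|}{\|u\|\,\|v\|}\ge\beta,\qquad \inf_{0\ne v\in H^1_0(U)}\ \sup_{0\ne u\in H^1_0(U)}\frac{|h(u,v)|}{\|u\|\,\|v\|}\ge\beta .$$ 2. For every $t\in H^1(U)$ there is a unique $t_0\in H^1_0(U)$ with $h(t_0,v)=-h(t,v)$ for all $v\in H^1_0(U)$. 3. Let $H^{1/2}(\partial U)=H^1(U)/H^1_0(U)$ be the space of traces of functions in $H^1(U)$, with the quotient topology. There is exactly one map $E:H^{1/2}(\partial U)\to H^1(U)$ such that $E\tau=t+t_0$ for every $\tau$ and every $t\in H^1(U)$ with trace $\tau$, where $t_0$ is as in 2. This map (the local Helmholtz extension operator) is linear and continuous, and $$\|E\tau\|\le\Bigl(1+\frac1\beta\Bigr)\|t\|\qquad\text{for every }\tau\in H^{1/2}(\partial U)\text{ and every }t\in H^1(U)\text{ with trace }\tau .$$ -/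

import Mathlib

open MeasureTheory TopologicalSpace
open scoped Distributions

noncomputable section

namespace Helmholtz

/-- The plane `ℝ²` with its Euclidean structure and Lebesgue measure `volume`. -/
abbrev Plane : Type := EuclideanSpace ℝ (Fin 2)

/-- `L²(U)`: square-integrable complex-valued functions on `U` (modulo equality a.e.). -/
abbrev L2 (U : Opens Plane) : Type :=
  Lp ℂ 2 (volume.restrict (U : Set Plane))

/-- The classical partial derivative `∂ᵢ φ (x)`. -/
def partialDeriv (i : Fin 2) (φ : Plane → ℂ) (x : Plane) : ℂ :=
  fderiv ℝ φ x (EuclideanSpace.single i 1)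

/-- `g` is the weak `i`-th partial derivative of `u` in `U`. -/
def IsWeakPartial (U : Opens Plane) (i : Fin 2) (u g : L2 U) : Prop :=
  ∀ φ : 𝓓(U, ℂ),
    ∫ x in (U : Set Plane), u x * partialDeriv i φ x = -∫ x in (U : Set Plane), g x * φ x

theorem memLp_testFunction {U : Opens Plane} (φ : 𝓓(U, ℂ)) :
    MemLp φ 2 (volume.restrict (U : Set Plane)) :=
  (φ.continuous.memLp_of_hasCompactSupport φ.hasCompactSupport).restrict _

theorem memLp_partialDeriv {U : Opens Plane} (φ : 𝓓(U, ℂ)) (i : Fin 2) :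
    MemLp (partialDeriv i φ) 2 (volume.restrict (U : Set Plane)) := by
  have hc : Continuous (partialDeriv i φ) :=
    (φ.contDiff.continuous_fderiv (by simp)).clm_apply continuous_const
  have hs : HasCompactSupport (partialDeriv i φ) :=
    φ.hasCompactSupport.fderiv_apply (𝕜 := ℝ) (EuclideanSpace.single i 1)
  exact (hc.memLp_of_hasCompactSupport hs).restrict _

theorem integrable_L2_mul {U : Opens Plane} (u : L2 U) {ψ : Plane → ℂ}
    (hψ : MemLp ψ 2 (volume.restrict (U : Set Plane))) :
    Integrable (fun x => u x * ψ x) (volume.restrict (U : Set Plane)) :=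
  (Lp.memLp u).integrable_mul hψ

theorem integral_add_mul {U : Opens Plane} (u v : L2 U) {ψ : Plane → ℂ}
    (hψ : MemLp ψ 2 (volume.restrict (U : Set Plane))) :
    ∫ x in (U : Set Plane), (u + v : L2 U) x * ψ x
      = (∫ x in (U : Set Plane), u x * ψ x) + ∫ x in (U : Set Plane), v x * ψ x := by
  rw [← integral_add (integrable_L2_mul u hψ) (integrable_L2_mul v hψ)]
  refine integral_congr_ae ?_
  filter_upwards [Lp.coeFn_add u v] with x hx
  rw [hx, Pi.add_apply, add_mul]

theorem integral_smul_mul {U : Opens Plane} (k : ℂ) (u : L2 U) (ψ : Plane → ℂ) :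
    ∫ x in (U : Set Plane), (k • u : L2 U) x * ψ x
      = k * ∫ x in (U : Set Plane), u x * ψ x := by
  rw [← integral_const_mul]
  refine integral_congr_ae ?_
  filter_upwards [Lp.coeFn_smul k u] with x hx
  rw [hx, Pi.smul_apply, smul_eq_mul, mul_assoc]

theorem integral_zero_mul {U : Opens Plane} (ψ : Plane → ℂ) :
    ∫ x in (U : Set Plane), (0 : L2 U) x * ψ x = 0 := by
  simpa using integral_smul_mul (0 : ℂ) (0 : L2 U) ψ

/-- The Sobolev space `H¹(U)`: pairs of an `L²` function and its weak gradient, which is again in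
`L²`. (The weak gradient is determined by the function.) Its topology, inherited from the product
of `L²` spaces, is the one of the `H¹`-norm. -/
def sobolevH1 (U : Opens Plane) : Submodule ℂ (L2 U × (Fin 2 → L2 U)) where
  carrier := {w | ∀ i, IsWeakPartial U i w.1 (w.2 i)}
  zero_mem' := by
    intro i φ
    change ∫ x in (U : Set Plane), (0 : L2 U) x * _ = -∫ x in (U : Set Plane), (0 : L2 U) x * _
    rw [integral_zero_mul, integral_zero_mul, neg_zero]
  add_mem' := by
    intro w z hw hz i φ
    change ∫ x in (U : Set Plane), (w.1 + z.1 : L2 U) x * _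
      = -∫ x in (U : Set Plane), (w.2 i + z.2 i : L2 U) x * _
    rw [integral_add_mul _ _ (memLp_partialDeriv φ i), integral_add_mul _ _ (memLp_testFunction φ),
      hw i φ, hz i φ, neg_add]
  smul_mem' := by
    intro k w hw i φ
    change ∫ x in (U : Set Plane), (k • w.1 : L2 U) x * _
      = -∫ x in (U : Set Plane), (k • w.2 i : L2 U) x * _
    rw [integral_smul_mul, integral_smul_mul, hw i φ, mul_neg]

/-- `H¹(U)` as a type. -/
abbrev H1 (U : Opens Plane) : Type := sobolevH1 U

/-- The function underlying an element of `H¹(U)`. -/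
def H1.fn {U : Opens Plane} (u : H1 U) : L2 U := u.1.1

/-- The `i`-th weak partial derivative of an element of `H¹(U)`. -/
def H1.grad {U : Opens Plane} (u : H1 U) (i : Fin 2) : L2 U := u.1.2 i

/-- `H¹₀(U)`: the closure in `H¹(U)` of the smooth functions with compact support in `U`. -/
def H10 (U : Opens Plane) : Submodule ℂ (H1 U) :=
  (Submodule.span ℂ
    {u : H1 U | ∃ φ : 𝓓(U, ℂ), u.fn =ᵐ[volume.restrict (U : Set Plane)] φ}).topologicalClosure

/-- The form `(u, v) ↦ ∫_U a ∇u · ∇v̄ dx` on `H¹(U)`. -/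
def diffForm (U : Opens Plane) (a : Plane → ℝ) (u v : H1 U) : ℂ :=
  ∫ x in (U : Set Plane), (a x : ℂ) * ∑ i, u.grad i x * starRingEnd ℂ (v.grad i x)

/-- The weighted inner product `(κ² u, v)_U = ∫_U κ² u v̄ dx`. -/
def massForm (U : Opens Plane) (κ : Plane → ℝ) (u v : H1 U) : ℂ :=
  ∫ x in (U : Set Plane), (κ x : ℂ) ^ 2 * u.fn x * starRingEnd ℂ (v.fn x)

/-- The local Helmholtz form `∫_U a ∇u · ∇v̄ dx - (κ² u, v)_U`. -/
def helmholtzForm (U : Opens Plane) (a κ : Plane → ℝ) (u v : H1 U) : ℂ :=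
  diffForm U a u v - massForm U κ u v

/-- The energy norm: the square root of `∫_U a |∇u|² dx + (κ² u, u)_U`. -/
def energyNorm (U : Opens Plane) (a κ : Plane → ℝ) (u : H1 U) : ℝ :=
  Real.sqrt (diffForm U a u u + massForm U κ u u).re

/-- The local Dirichlet eigenvalues: real `μ` for which there is a nonzero `b ∈ H¹₀(U)` with
`∫_U a ∇b · ∇v̄ dx = μ (κ² b, v)_U` for all `v ∈ H¹₀(U)`. -/
def dirichletEigenvalues (U : Opens Plane) (a κ : Plane → ℝ) : Set ℝ :=
  {μ | ∃ b ∈ H10 U, b ≠ 0 ∧ ∀ v ∈ H10 U, diffForm U a b v = (μ : ℂ) * massForm U κ b v}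

/-- The constant `inf |μ - 1| / (μ + 1)` over all local Dirichlet eigenvalues `μ`. -/
def infSupConst (U : Opens Plane) (a κ : Plane → ℝ) : ℝ :=
  ⨅ μ : dirichletEigenvalues U a κ, |(μ : ℝ) - 1| / ((μ : ℝ) + 1)

/-- The space `H^{1/2}(∂U)` of traces of functions in `H¹(U)`. Two functions have the same trace
if and only if their difference lies in `H¹₀(U)`, so this is the quotient `H¹(U) / H¹₀(U)`. -/
abbrev TraceSpace (U : Opens Plane) : Type := H1 U ⧸ H10 U

/-- The trace of a function in `H¹(U)`. -/
def trace {U : Opens Plane} (u : H1 U) : TraceSpace U := (H10 U).mkQ u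

/-- `w ∈ H¹₀(U)` solves the local Helmholtz problem whose right-hand side is minus the residual of
`t ∈ H¹(U)`. -/
def IsCorrection (U : Opens Plane) (a κ : Plane → ℝ) (t w : H1 U) : Prop :=
  w ∈ H10 U ∧ ∀ v ∈ H10 U, helmholtzForm U a κ w v = -helmholtzForm U a κ t v

/-- `E` is the local Helmholtz extension operator: `E τ = t + t₀` for any `t ∈ H¹(U)` with
trace `τ`, where `t₀ ∈ H¹₀(U)` solves the local Helmholtz problem associated with `t`. -/
def IsHelmholtzExtension (U : Opens Plane) (a κ : Plane → ℝ) (E : TraceSpace U → H1 U) : Prop :=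
  ∀ (τ : TraceSpace U) (t : H1 U), trace t = τ →
    ∃ t₀ : H1 U, IsCorrection U a κ t t₀ ∧ E τ = t + t₀

end Helmholtz

end

/-! The map `u ↦ (κ u, √a ∇u)` sends `H¹(U)` injectively into a Hilbert space of `L²` pairs. There
the energy norm is the Hilbert norm and `h(u, v) = ⟪Jv, R Ju⟫` with the isometric reflection `R (u,
g) = (-u, g)`. Let `V` be the image of `H¹₀(U)` and `L : V → L²(U)` the first component. The
compression of `R` to `V` is `S = 1 - 2 L†L`.

By the Rellich theorem (`isCompactOperator_energyFst`), `L` is compact, so `L†L` is compact,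
symmetric and, `L` being injective, has only positive eigenvalues. They are exactly the numbers
`1/(λ+1)` with `λ ∈ Λ`, so `S` has the eigenvalues `(λ-1)/(λ+1)`. Density of the span of the
eigenvectors gives `‖S u‖ ≥ β ‖u‖` (`spectralGap_mul_norm_le`), and `1 ∉ Λ` keeps the eigenvalues of
`L†L` away from `1/2`, so `β > 0` (`spectralGap_pos`).

The test function `v = S u` yields the first inf-sup bound, and the second follows because `h` is
Hermitian. The Fredholm alternative makes `S` invertible, whence `t₀ = -S⁻¹ Pr R t` with `Pr` the
orthogonal projection onto `V`, and `‖t₀‖ ≤ ‖t‖ / β`. If `t ∈ H¹₀(U)` then `t₀ = -t`, so `t + t₀`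
depends only on the trace.

Compactness rests on a Poincaré estimate over a fine grid: when the finitely many cell means of `u`
vanish, the `L²` norm is a small multiple of the gradient norm. Hence `L` is a norm limit of
finite-rank operators. -/

noncomputable section

/-! ### Compact operators: spectral lower bounds and a compactness criterion. -/

section Spectral

variable {V : Type*} [NormedAddCommGroup V] [InnerProductSpace ℂ V] [CompleteSpace V]

/-- If a compact symmetric operator has no eigenvalue at distance less than `β` from `z`, then
`T - z` is bounded below by `β`. -/
theorem IsCompactOperator.mul_norm_le_norm_sub_smul {T : V →L[ℂ] V} (hT : IsCompactOperator T)
    (hs : T.IsSymmetric) (z : ℂ) {β : ℝ} (hβ : 0 ≤ β)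
    (h : ∀ θ, Module.End.HasEigenvalue (T : Module.End ℂ V) θ → β ≤ ‖θ - z‖) (u : V) :
    β * ‖u‖ ≤ ‖T u - z • u‖ := by
  classical
  have hs' : (T : V →ₗ[ℂ] V).IsSymmetric := hs
  set E : Submodule ℂ V := ⨆ θ, Module.End.eigenspace (T : Module.End ℂ V) θ with hE
  have hdense : Dense (E : Set V) := by
    rw [Submodule.dense_iff_topologicalClosure_eq_top, Submodule.topologicalClosure_eq_top_iff]
    exact ContinuousLinearMap.orthogonalComplement_iSup_eigenspaces_eq_bot hT hs
  -- Both sides are continuous in `u`, so finite sums of eigenvectors suffice; on their orthogonal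
  -- components `T - z` acts as the scalar `θ - z`.
  refine hdense.induction (P := fun u => β * ‖u‖ ≤ ‖T u - z • u‖) ?_
    (isClosed_le (by fun_prop) (by fun_prop)) u
  intro x hx
  rw [SetLike.mem_coe, hE, Submodule.mem_iSup_iff_exists_dfinsupp'] at hx
  obtain ⟨f, rfl⟩ := hx
  have hof := hs'.orthogonalFamily_eigenspaces
  have h1 : ‖f.sum fun _ xi => (xi : V)‖ ^ 2 = ∑ i ∈ f.support, ‖f i‖ ^ 2 :=
    hof.norm_sum (fun i => f i) f.support
  have h2 : ‖T (f.sum fun _ xi => (xi : V)) - z • f.sum fun _ xi => (xi : V)‖ ^ 2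
      = ∑ i ∈ f.support, ‖(i - z) • f i‖ ^ 2 := by
    rw [← hof.norm_sum (fun i => (i - z) • f i) f.support]
    congr 2
    rw [DFinsupp.sum, map_sum, Finset.smul_sum, ← Finset.sum_sub_distrib]
    refine Finset.sum_congr rfl fun i _ => ?_
    have := Module.End.mem_eigenspace_iff.1 (f i).2
    change T (f i) - z • (f i : V) = (i - z) • (f i : V)
    rw [sub_smul, ← this]; rfl
  refine le_of_sq_le_sq ?_ (norm_nonneg _)
  rw [mul_pow, h1, h2, Finset.mul_sum]
  refine Finset.sum_le_sum fun i hi => ?_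
  rw [norm_smul, mul_pow]
  gcongr
  refine h i fun hbot => (DFinsupp.mem_support_iff.1 hi) ?_
  have := hbot.le (f i).2
  exact Subtype.ext this

/-- A nonzero number that is not an eigenvalue of a compact operator has positive distance from
the eigenvalues. -/
theorem IsCompactOperator.exists_pos_le_norm_sub {V : Type*} [NormedAddCommGroup V]
    [NormedSpace ℂ V] {T : V →L[ℂ] V} (hT : IsCompactOperator T)
    {z : ℂ} (hz : z ≠ 0) (h : ¬ Module.End.HasEigenvalue (T : Module.End ℂ V) z) :
    ∃ δ > 0, ∀ θ, Module.End.HasEigenvalue (T : Module.End ℂ V) θ → δ ≤ ‖θ - z‖ := by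
  -- By the Fredholm theory of compact operators `T - z` is bounded below; on an eigenvector for `θ`
  -- it has the size `‖θ - z‖`.
  obtain ⟨K, hK⟩ := hT.antilipschitz_of_not_hasEigenvalue hz h
  obtain ⟨c, hc, hcK⟩ := antilipschitzWith_iff_exists_mul_le_norm.1 ⟨K, hK⟩
  refine ⟨c, hc, fun θ hθ => ?_⟩
  obtain ⟨v, hv⟩ := hθ.exists_hasEigenvector
  have h1 := hcK v
  have h2 : (T - z • 1 : V →L[ℂ] V) v = (θ - z) • v := by
    have : T v = θ • v := hv.apply_eq_smul
    simp [this, sub_smul]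
  rw [h2, norm_smul] at h1
  exact le_of_mul_le_mul_right h1 (norm_pos_iff.2 hv.2)

/-- A bounded operator on a Hilbert space is compact if, up to an arbitrarily small multiple of
the norm, it is controlled by finitely many functionals. -/
theorem isCompactOperator_of_forall_exists_finite {F : Type*} [NormedAddCommGroup F]
    [NormedSpace ℂ F] [CompleteSpace F] (L : V →L[ℂ] F)
    (h : ∀ ε > 0, ∃ (ι : Type) (_ : Fintype ι) (l : ι → V →L[ℂ] ℂ),
      ∀ u, (∀ i, l i u = 0) → ‖L u‖ ≤ ε * ‖u‖) : IsCompactOperator L := by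
  -- Compact operators are closed in operator norm, so a finite-rank operator within `ε` of `L` is
  -- enough.
  refine (isClosed_setOfPred_isCompactOperator (σ₁₂ := RingHom.id ℂ) (M₁ := V)
    (M₂ := F)).closure_subset_iff.2 subset_rfl ?_
  rw [Metric.mem_closure_iff]
  intro ε hε
  obtain ⟨ι, _, l, hl⟩ := h (ε / 2) (by positivity)
  let P : V →L[ℂ] (ι → ℂ) := ContinuousLinearMap.pi l
  let W : Submodule ℂ V := P.ker
  have hWc : IsClosed (W : Set V) := P.isClosed_ker
  have : CompleteSpace W := hWc.completeSpace_coe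
  have : FiniteDimensional ℂ Wᗮ := by
    refine FiniteDimensional.of_injective ((P : V →ₗ[ℂ] (ι → ℂ)) ∘ₗ Wᗮ.subtype) ?_
    rw [← LinearMap.ker_eq_bot, LinearMap.ker_eq_bot']
    rintro ⟨x, hx⟩ hx0
    have hxW : x ∈ W := hx0
    exact Subtype.ext (inner_self_eq_zero (𝕜 := ℂ).1 (hx x hxW))
  -- The error of this approximation is `L` composed with the projection onto `W`, where all the
  -- functionals vanish.
  refine ⟨L ∘L Wᗮ.subtypeL ∘L Wᗮ.orthogonalProjectionOnto, ?_, ?_⟩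
  · have : ProperSpace Wᗮ := FiniteDimensional.proper ℂ _
    exact ((isCompactOperator_of_locallyCompactSpace_dom
      (Wᗮ.orthogonalProjectionOnto)).clm_comp (L ∘L Wᗮ.subtypeL))
  · rw [dist_eq_norm]
    refine lt_of_le_of_lt (ContinuousLinearMap.opNorm_le_bound _ (M := ε / 2) (by positivity)
      fun u => ?_) (by linarith)
    have h1 : (L - L ∘L Wᗮ.subtypeL ∘L Wᗮ.orthogonalProjectionOnto) u
        = L (W.orthogonalProjectionOnto u : V) := by
      simp [Submodule.orthogonalProjectionOnto_orthogonal]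
    rw [h1]
    refine (hl _ fun i => congrFun (W.orthogonalProjectionOnto u).2 i).trans ?_
    gcongr
    exact W.norm_orthogonalProjectionOnto_apply_le u

end Spectral

/-! ### Translation estimates and mean oscillation. -/

section Translation

variable {E : Type*} [NormedAddCommGroup E] [NormedSpace ℝ E] [MeasurableSpace E] [BorelSpace E]
  [FiniteDimensional ℝ E] (μ : Measure E) [μ.IsAddHaarMeasure]

open ENNReal

theorem sq_lintegral_le_lintegral_sq {α : Type*} [MeasurableSpace α] (ν : Measure α)
    [IsProbabilityMeasure ν] {f : α → ℝ≥0∞} (hf : AEMeasurable f ν) :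
    (∫⁻ a, f a ∂ν) ^ 2 ≤ ∫⁻ a, f a ^ 2 ∂ν := by
  have h := ENNReal.lintegral_mul_le_Lp_mul_Lq ν Real.HolderConjugate.two_two hf
    (aemeasurable_const (b := 1))
  simp only [Pi.mul_apply, mul_one, one_rpow, lintegral_const, measure_univ] at h
  calc (∫⁻ a, f a ∂ν) ^ 2 ≤ ((∫⁻ a, f a ^ (2 : ℝ) ∂ν) ^ (1 / (2 : ℝ))) ^ 2 := by gcongr
    _ = ∫⁻ a, f a ^ 2 ∂ν := by
      rw [← ENNReal.rpow_natCast, ← ENNReal.rpow_mul]; norm_num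

/-- The `L²` norm of a difference of translates is controlled by the gradient. -/
theorem lintegral_enorm_translate_sub_sq_le {φ : E → ℂ} (hφ : ContDiff ℝ 1 φ) (h : E) :
    ∫⁻ x, ‖φ (x + h) - φ x‖ₑ ^ 2 ∂μ ≤ ‖h‖ₑ ^ 2 * ∫⁻ x, ‖fderiv ℝ φ x‖ₑ ^ 2 ∂μ := by
  have hc : Continuous (fderiv ℝ φ) := hφ.continuous_fderiv one_ne_zero
  let ν : Measure ℝ := volume.restrict (Set.Icc 0 1)
  have : IsProbabilityMeasure ν := ⟨by simp [ν]⟩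
  -- The fundamental theorem of calculus on the segment from `x` to `x + h`, then Jensen on `[0,
  -- 1]`. Translation invariance of `μ` later removes the dependence on `t`.
  have hpt : ∀ x, ‖φ (x + h) - φ x‖ₑ ^ 2 ≤ ∫⁻ t, ‖h‖ₑ ^ 2 * ‖fderiv ℝ φ (x + t • h)‖ₑ ^ 2 ∂ν := by
    intro x
    have hd : ∀ t : ℝ, HasDerivAt (fun t : ℝ => φ (x + t • h)) (fderiv ℝ φ (x + t • h) h) t := by
      intro t
      have h1 : HasDerivAt (fun t : ℝ => x + t • h) h t := by
        simpa using ((hasDerivAt_id t).smul_const h).const_add x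
      exact ((hφ.differentiable one_ne_zero _).hasFDerivAt.comp_hasDerivAt t h1)
    have hcont : Continuous fun t : ℝ => fderiv ℝ φ (x + t • h) h := by fun_prop
    have hftc : φ (x + h) - φ x = ∫ t, fderiv ℝ φ (x + t • h) h ∂ν := by
      have := intervalIntegral.integral_eq_sub_of_hasDerivAt (a := 0) (b := 1)
        (fun t _ => hd t) (hcont.intervalIntegrable _ _)
      rw [intervalIntegral.integral_of_le zero_le_one, ← integral_Icc_eq_integral_Ioc] at this
      rw [this]; simp
    calc ‖φ (x + h) - φ x‖ₑ ^ 2 ≤ (∫⁻ t, ‖fderiv ℝ φ (x + t • h) h‖ₑ ∂ν) ^ 2 := by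
          rw [hftc]; gcongr; exact enorm_integral_le_lintegral_enorm _
      _ ≤ ∫⁻ t, ‖fderiv ℝ φ (x + t • h) h‖ₑ ^ 2 ∂ν :=
          sq_lintegral_le_lintegral_sq ν hcont.enorm.aemeasurable
      _ ≤ _ := by
          refine lintegral_mono fun t => ?_
          rw [← mul_pow, mul_comm]
          gcongr
          exact ContinuousLinearMap.le_opENorm _ _
  calc ∫⁻ x, ‖φ (x + h) - φ x‖ₑ ^ 2 ∂μ
      ≤ ∫⁻ x, ∫⁻ t, ‖h‖ₑ ^ 2 * ‖fderiv ℝ φ (x + t • h)‖ₑ ^ 2 ∂ν ∂μ := lintegral_mono hpt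
    _ = ∫⁻ t, ∫⁻ x, ‖h‖ₑ ^ 2 * ‖fderiv ℝ φ (x + t • h)‖ₑ ^ 2 ∂μ ∂ν := by
        refine lintegral_lintegral_swap (Continuous.aemeasurable ?_)
        have : Continuous fun p : E × ℝ => fderiv ℝ φ (p.1 + p.2 • h) := by fun_prop
        exact (ENNReal.continuous_const_mul (by simp)).comp
          ((ENNReal.continuous_pow 2).comp this.enorm)
    _ = ∫⁻ t, ‖h‖ₑ ^ 2 * ∫⁻ x, ‖fderiv ℝ φ x‖ₑ ^ 2 ∂μ ∂ν := by
        refine lintegral_congr fun t => ?_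
        rw [lintegral_const_mul' _ _ (by simp),
          lintegral_add_right_eq_self (fun x => ‖fderiv ℝ φ x‖ₑ ^ 2)]
    _ = _ := by simp

/-- The variance identity. -/
theorem integral_integral_norm_sub_sq {α : Type*} [MeasurableSpace α] (ν : Measure α)
    [IsFiniteMeasure ν] {f : α → ℂ} (hf : MemLp f 2 ν) :
    ∫ x, ∫ y, ‖f x - f y‖ ^ 2 ∂ν ∂ν
      = 2 * ν.real Set.univ * ∫ x, ‖f x‖ ^ 2 ∂ν - 2 * ‖∫ x, f x ∂ν‖ ^ 2 := by
  have hi : Integrable f ν := hf.integrable one_le_two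
  have hi2 : Integrable (fun x => ‖f x‖ ^ 2) ν := hf.integrable_norm_pow (by norm_num)
  have key : ∀ (w : ℂ), ∫ y, ‖w - f y‖ ^ 2 ∂ν
      = ν.real Set.univ * ‖w‖ ^ 2 + ∫ y, ‖f y‖ ^ 2 ∂ν - 2 * inner ℝ (∫ y, f y ∂ν) w := by
    intro w
    have h1 : ∀ y, ‖w - f y‖ ^ 2 = ‖w‖ ^ 2 + ‖f y‖ ^ 2 - 2 * inner ℝ (f y) w := by
      intro y; rw [norm_sub_sq_real, real_inner_comm]; ring
    simp_rw [h1]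
    have hin : Integrable (fun y => 2 * inner ℝ (f y) w) ν := (hi.inner_const w).const_mul 2
    rw [integral_sub (f := fun y => ‖w‖ ^ 2 + ‖f y‖ ^ 2) ((integrable_const _).add hi2) hin,
      integral_add (integrable_const _) hi2, integral_const_mul, integral_const]
    congr 2
    simp_rw [real_inner_comm w]
    exact integral_inner hi w
  simp_rw [key]
  have hin : Integrable (fun x => 2 * inner ℝ (∫ y, f y ∂ν) (f x)) ν :=
    (hi.const_inner _).const_mul 2
  rw [integral_sub (f := fun x => ν.real Set.univ * ‖f x‖ ^ 2 + ∫ y, ‖f y‖ ^ 2 ∂ν)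
      ((hi2.const_mul _).add (integrable_const _)) hin,
    integral_add (hi2.const_mul _) (integrable_const _), integral_const_mul, integral_const_mul,
    integral_inner hi, real_inner_self_eq_norm_sq, integral_const]
  simp only [smul_eq_mul]
  ring

/-- On a set `Q` of finite measure, the mean square is controlled by the mean and by the
mean square oscillation. -/
theorem lintegral_enorm_sq_le_mean_add {α : Type*} [MeasurableSpace α] (ν : Measure α)
    [IsFiniteMeasure ν] {f : α → ℂ} (hf : MemLp f 2 ν) :
    ν Set.univ * ∫⁻ x, ‖f x‖ₑ ^ 2 ∂ν
      ≤ ‖∫ x, f x ∂ν‖ₑ ^ 2 + ∫⁻ x, ∫⁻ y, ‖f x - f y‖ₑ ^ 2 ∂ν ∂ν := by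
  have hi : Integrable f ν := hf.integrable one_le_two
  have hconv : ∀ z : ℂ, ‖z‖ₑ ^ 2 = ENNReal.ofReal (‖z‖ ^ 2) := fun z => by
    rw [ENNReal.ofReal_pow (norm_nonneg _), ofReal_norm]
  have hint : ∀ {g : α → ℂ}, MemLp g 2 ν →
      ∫⁻ x, ‖g x‖ₑ ^ 2 ∂ν = ENNReal.ofReal (∫ x, ‖g x‖ ^ 2 ∂ν) := fun {g} hg => by
    rw [ofReal_integral_eq_lintegral_ofReal (hg.integrable_norm_pow (by norm_num))
      (.of_forall fun x => by positivity)]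
    exact lintegral_congr fun x => hconv _
  have h2 : ENNReal.ofReal (∫ x, ∫ y, ‖f x - f y‖ ^ 2 ∂ν ∂ν)
      ≤ ∫⁻ x, ∫⁻ y, ‖f x - f y‖ₑ ^ 2 ∂ν ∂ν := by
    -- Only this inequality is needed, and it requires no integrability of the outer integrand.
    refine (Real.ofReal_le_enorm _).trans
      ((enorm_integral_le_lintegral_enorm _).trans (le_of_eq ?_))
    refine lintegral_congr fun x => ?_
    rw [Real.enorm_of_nonneg (by positivity)]
    exact (hint ((memLp_const (f x)).sub hf)).symm
  refine le_trans ?_ (add_le_add_right h2 _)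
  rw [hint hf, hconv, ← ofReal_measureReal, ← ENNReal.ofReal_mul (by positivity),
    ← ENNReal.ofReal_add (by positivity) (by positivity),
    integral_integral_norm_sub_sq ν hf]
  refine ENNReal.ofReal_le_ofReal ?_
  -- The variance identity carries a factor `1/2` on the oscillation; nonnegativity allows it to be
  -- dropped.
  have h3 : 0 ≤ ∫ x, ∫ y, ‖f x - f y‖ ^ 2 ∂ν ∂ν := by positivity
  rw [integral_integral_norm_sub_sq ν hf] at h3
  linarith

/-- Oscillations over pairs of points in a common cell of a partition into small sets. -/
theorem sum_lintegral_lintegral_sub_sq_le {φ : E → ℂ} (hφ : ContDiff ℝ 1 φ) {r : ℝ}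
    {ι : Type*} (K : Finset ι) (Q : ι → Set E) (hQm : ∀ k, MeasurableSet (Q k))
    (hQd : Pairwise (Function.onFun Disjoint Q))
    (hQr : ∀ k, ∀ x ∈ Q k, ∀ y ∈ Q k, dist y x < r) :
    ∑ k ∈ K, ∫⁻ x in Q k, ∫⁻ y in Q k, ‖φ x - φ y‖ₑ ^ 2 ∂μ ∂μ
      ≤ μ (Metric.ball 0 r) * (ENNReal.ofReal r ^ 2 * ∫⁻ x, ‖fderiv ℝ φ x‖ₑ ^ 2 ∂μ) := by
  have hc : Continuous φ := hφ.continuous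
  calc ∑ k ∈ K, ∫⁻ x in Q k, ∫⁻ y in Q k, ‖φ x - φ y‖ₑ ^ 2 ∂μ ∂μ
      ≤ ∑ k ∈ K, ∫⁻ x in Q k, ∫⁻ h in Metric.ball 0 r, ‖φ (x + h) - φ x‖ₑ ^ 2 ∂μ ∂μ := by
        refine Finset.sum_le_sum fun k _ => setLIntegral_mono' (hQm k) fun x hx => ?_
        -- Substitute `y = x + h`: two points of one cell differ by an `h` in the ball of radius
        -- `r`.
        rw [← lintegral_indicator (hQm k), ← lintegral_indicator Metric.isOpen_ball.measurableSet,
          ← lintegral_add_left_eq_self _ x]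
        refine lintegral_mono fun h => ?_
        by_cases hh : x + h ∈ Q k
        · have hb : h ∈ Metric.ball (0 : E) r := by
            have := hQr k x hx _ hh
            simpa using this
          rw [Set.indicator_of_mem hh, Set.indicator_of_mem hb, ← enorm_neg, neg_sub]
        · rw [Set.indicator_of_notMem hh]; exact zero_le
    _ = ∫⁻ x in ⋃ k ∈ K, Q k, ∫⁻ h in Metric.ball 0 r, ‖φ (x + h) - φ x‖ₑ ^ 2 ∂μ ∂μ := by
        rw [lintegral_biUnion_finset (fun i _ j _ hij => hQd hij) fun k _ => hQm k]
    _ ≤ ∫⁻ x, ∫⁻ h in Metric.ball 0 r, ‖φ (x + h) - φ x‖ₑ ^ 2 ∂μ ∂μ :=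
        setLIntegral_le_lintegral _ _
    _ = ∫⁻ h in Metric.ball 0 r, ∫⁻ x, ‖φ (x + h) - φ x‖ₑ ^ 2 ∂μ ∂μ := by
        refine lintegral_lintegral_swap (Continuous.aemeasurable ?_)
        have : Continuous fun p : E × E => φ (p.1 + p.2) - φ p.1 := by fun_prop
        exact (ENNReal.continuous_pow 2).comp this.enorm
    _ ≤ ∫⁻ h in Metric.ball 0 r, ENNReal.ofReal r ^ 2 * ∫⁻ x, ‖fderiv ℝ φ x‖ₑ ^ 2 ∂μ ∂μ := by
        refine setLIntegral_mono' Metric.isOpen_ball.measurableSet fun h hh => ?_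
        refine (lintegral_enorm_translate_sub_sq_le μ hφ h).trans ?_
        gcongr
        rw [← ofReal_norm]
        exact ENNReal.ofReal_le_ofReal (mem_ball_zero_iff.1 hh).le
    _ = _ := by rw [setLIntegral_const, mul_comm]

end Translation

/-! ### Square grids and a Poincaré inequality. -/

namespace Helmholtz

open ENNReal

/-- The cells of the square grid of width `ε`. -/
def gridCell (ε : ℝ) (k : Fin 2 → ℤ) : Set Plane := {x | ∀ i, ⌊x i / ε⌋ = k i}

theorem measurableSet_gridCell (ε : ℝ) (k : Fin 2 → ℤ) : MeasurableSet (gridCell ε k) := by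
  have : gridCell ε k = ⋂ i, (fun x : Plane => ⌊x i / ε⌋) ⁻¹' {k i} := by
    ext x; simp [gridCell]
  rw [this]
  refine MeasurableSet.iInter fun i => ?_
  have : Measurable fun x : Plane => ⌊x i / ε⌋ := by fun_prop
  exact this (measurableSet_singleton _)

theorem pairwise_disjoint_gridCell (ε : ℝ) :
    Pairwise (Function.onFun Disjoint (gridCell ε)) := by
  intro k l hkl
  rw [Function.onFun, Set.disjoint_left]
  exact fun x hx hy => hkl (funext fun i => (hx i).symm.trans (hy i))

theorem dist_lt_of_mem_gridCell {ε : ℝ} (hε : 0 < ε) {k : Fin 2 → ℤ} {x y : Plane}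
    (hx : x ∈ gridCell ε k) (hy : y ∈ gridCell ε k) : dist y x < 2 * ε := by
  have h : ∀ i, dist (y i) (x i) ^ 2 < ε ^ 2 := by
    intro i
    have h1 := Int.abs_sub_lt_one_of_floor_eq_floor ((hy i).trans (hx i).symm)
    rw [← sub_div, abs_div, abs_of_pos hε, div_lt_one hε] at h1
    rw [Real.dist_eq]
    exact pow_lt_pow_left₀ h1 (abs_nonneg _) two_ne_zero
  rw [EuclideanSpace.dist_eq, Real.sqrt_lt' (by positivity), Fin.sum_univ_two]
  nlinarith [h 0, h 1]

theorem exists_ball_subset_gridCell {ε : ℝ} (hε : 0 < ε) (k : Fin 2 → ℤ) :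
    ∃ c, Metric.ball c (ε / 2) ⊆ gridCell ε k := by
  refine ⟨WithLp.toLp 2 fun i => (k i + 1 / 2) * ε, fun x hx i => ?_⟩
  have h1 : |x i - (k i + 1 / 2) * ε| < ε / 2 := by
    refine lt_of_le_of_lt ?_ (mem_ball_iff_norm.1 hx)
    exact PiLp.norm_apply_le (x - WithLp.toLp 2 fun i => (k i + 1 / 2) * ε) i
  rw [abs_lt] at h1
  rw [Int.floor_eq_iff, le_div_iff₀ hε, div_lt_iff₀ hε]
  constructor <;> nlinarith [h1.1, h1.2]

theorem exists_finset_subset_iUnion_gridCell {ε : ℝ} (hε : 0 < ε) {s : Set Plane}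
    (hs : Bornology.IsBounded s) :
    ∃ K : Finset (Fin 2 → ℤ), s ⊆ ⋃ k ∈ K, gridCell ε k := by
  obtain ⟨R, hR⟩ := hs.exists_norm_le
  refine ⟨Finset.Icc (fun _ => ⌊-R / ε⌋) (fun _ => ⌊R / ε⌋), fun x hx => ?_⟩
  have h1 : ∀ i, |x i| ≤ R := fun i => (PiLp.norm_apply_le x i).trans (hR x hx)
  refine Set.mem_iUnion₂.2 ⟨fun i => ⌊x i / ε⌋, Finset.mem_Icc.2 ⟨fun i => ?_, fun i => ?_⟩,
    fun i => rfl⟩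
  · have := (abs_le.1 (h1 i)).1
    exact Int.floor_mono (by gcongr)
  · have := (abs_le.1 (h1 i)).2
    exact Int.floor_mono (by gcongr)

theorem volume_gridCell_lt_top {ε : ℝ} (hε : 0 < ε) (k : Fin 2 → ℤ) :
    volume (gridCell ε k) < ∞ := by
  obtain ⟨c, hc⟩ := exists_ball_subset_gridCell hε k
  have hcc : c ∈ gridCell ε k := hc (Metric.mem_ball_self (by positivity))
  have : gridCell ε k ⊆ Metric.ball c (2 * ε) := fun y hy =>
    dist_lt_of_mem_gridCell hε hcc hy
  exact (measure_mono this).trans_lt measure_ball_lt_top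

/-- A Poincaré inequality: up to its means over the grid cells, a function is controlled by a small
multiple of its gradient. -/
theorem lintegral_enorm_sq_le_sum_mean_add {ε : ℝ} (hε : 0 < ε) {φ : Plane → ℂ}
    (hφ : ContDiff ℝ 1 φ) (hφ2 : MemLp φ 2) {s : Set Plane} {K : Finset (Fin 2 → ℤ)}
    (hs : s ⊆ ⋃ k ∈ K, gridCell ε k) :
    volume (Metric.ball (0 : Plane) (ε / 2)) * ∫⁻ x in s, ‖φ x‖ₑ ^ 2
      ≤ ∑ k ∈ K, ‖∫ x in gridCell ε k, φ x‖ₑ ^ 2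
        + volume (Metric.ball (0 : Plane) (2 * ε)) *
          (ENNReal.ofReal (2 * ε) ^ 2 * ∫⁻ x, ‖fderiv ℝ φ x‖ₑ ^ 2) := by
  have h1 := sum_lintegral_lintegral_sub_sq_le volume hφ (r := 2 * ε) K (gridCell ε)
    (measurableSet_gridCell ε) (pairwise_disjoint_gridCell ε)
    fun k x hx y hy => dist_lt_of_mem_gridCell hε hx hy
  refine le_trans ?_ (add_le_add_right h1 _)
  rw [← Finset.sum_add_distrib]
  calc volume (Metric.ball (0 : Plane) (ε / 2)) * ∫⁻ x in s, ‖φ x‖ₑ ^ 2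
      ≤ volume (Metric.ball (0 : Plane) (ε / 2)) * ∑ k ∈ K, ∫⁻ x in gridCell ε k, ‖φ x‖ₑ ^ 2 := by
        rw [← lintegral_biUnion_finset (fun i _ j _ hij => pairwise_disjoint_gridCell ε hij)
          fun k _ => measurableSet_gridCell ε k]
        gcongr
    _ = ∑ k ∈ K, volume (Metric.ball (0 : Plane) (ε / 2)) *
          ∫⁻ x in gridCell ε k, ‖φ x‖ₑ ^ 2 := Finset.mul_sum _ _ _
    _ ≤ _ := by
        refine Finset.sum_le_sum fun k _ => ?_
        have : IsFiniteMeasure (volume.restrict (gridCell ε k)) :=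
          ⟨by simpa using volume_gridCell_lt_top hε k⟩
        refine le_trans ?_ (lintegral_enorm_sq_le_mean_add (volume.restrict (gridCell ε k))
          (hφ2.restrict _))
        -- An inscribed ball of radius `ε / 2` bounds the measure of every cell from below by one
        -- constant.
        obtain ⟨c, hc⟩ := exists_ball_subset_gridCell hε k
        refine mul_le_mul_left ?_ _
        rw [Measure.restrict_apply_univ, ← Measure.addHaar_ball_center volume c]
        exact measure_mono hc

end Helmholtz

/-! ### Weak derivatives and test functions in `H¹₀(U)`. -/

namespace Helmholtz

open ENNReal ContDiff

variable {U : Opens Plane}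

theorem setIntegral_mul_testFunction (f : Plane → ℂ) (φ : 𝓓(U, ℂ)) :
    ∫ x in (U : Set Plane), f x * φ x = ∫ x, f x * φ x := by
  refine setIntegral_eq_integral_of_forall_compl_eq_zero fun x hx => ?_
  rw [image_eq_zero_of_notMem_tsupport fun h => hx (φ.tsupport_subset h), mul_zero]

/-- A real-valued test function, regarded as complex-valued. -/
def ofRealTestFunction {ψ : Plane → ℝ} (hψ : ContDiff ℝ ∞ ψ) (hψc : HasCompactSupport ψ)
    (hψU : tsupport ψ ⊆ U) : 𝓓(U, ℂ) :=
  { toFun := fun x => (ψ x : ℂ)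
    contDiff' := Complex.ofRealCLM.contDiff.comp hψ
    hasCompactSupport' := hψc.comp_left (g := Complex.ofReal) rfl
    tsupport_subset' := (tsupport_comp_subset (g := Complex.ofReal) rfl ψ).trans hψU }

/-- A function in `L²(U)` that is orthogonal to the test functions vanishes. -/
theorem eq_zero_of_forall_setIntegral_mul_eq_zero (g : L2 U)
    (h : ∀ φ : 𝓓(U, ℂ), ∫ x in (U : Set Plane), g x * φ x = 0) : g = 0 := by
  rw [Lp.eq_zero_iff_ae_eq_zero]
  have h1 : LocallyIntegrable g (volume.restrict (U : Set Plane)) :=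
    (Lp.memLp g).locallyIntegrable one_le_two
  have h2 : LocallyIntegrableOn g (U : Set Plane) :=
    locallyIntegrableOn_of_locallyIntegrable_restrict h1
  refine (ae_restrict_iff' U.isOpen.measurableSet).2
    (U.isOpen.ae_eq_zero_of_integral_contDiff_smul_eq_zero h2 fun ψ hψ hψc hψU => ?_)
  let φ : 𝓓(U, ℂ) := ofRealTestFunction hψ hψc hψU
  have h3 := h φ
  rw [setIntegral_mul_testFunction] at h3
  rw [← h3]
  refine integral_congr_ae (.of_forall fun x => ?_)
  change (ψ x : ℝ) • g x = g x * (ψ x : ℂ)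
  rw [Complex.real_smul, mul_comm]

theorem IsWeakPartial.unique {i : Fin 2} {u g g' : L2 U} (h : IsWeakPartial U i u g)
    (h' : IsWeakPartial U i u g') : g = g' := by
  rw [← sub_eq_zero]
  refine eq_zero_of_forall_setIntegral_mul_eq_zero _ fun φ => ?_
  have h1 := integral_add_mul g ((-1 : ℂ) • g') (memLp_testFunction φ)
  rw [integral_smul_mul, neg_one_smul, ← sub_eq_add_neg] at h1
  rw [h1]
  linear_combination h φ - h' φ

/-- An element of `H¹(U)` is determined by its underlying function. -/
theorem H1.fn_injective : Function.Injective (H1.fn : H1 U → L2 U) := by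
  intro u v huv
  refine Subtype.ext (Prod.ext huv (funext fun i => ?_))
  have h := v.2 i
  exact (u.2 i).unique (by rw [show u.1.1 = v.1.1 from huv]; exact h)

/-- The element of `L²(U)` given by a classical partial derivative of a test function. -/
def partialDerivLp (φ : 𝓓(U, ℂ)) (i : Fin 2) : L2 U := (memLp_partialDeriv φ i).toLp _

/-- A test function as an element of `L²(U)`. -/
def testLp (φ : 𝓓(U, ℂ)) : L2 U := (memLp_testFunction φ).toLp _

theorem isWeakPartial_testLp (φ : 𝓓(U, ℂ)) (i : Fin 2) :
    IsWeakPartial U i (testLp φ) (partialDerivLp φ i) := by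
  intro ψ
  have e1 : ∫ x in (U : Set Plane), testLp φ x * partialDeriv i ψ x
      = ∫ x in (U : Set Plane), partialDeriv i ψ x * φ x := by
    refine integral_congr_ae ?_
    filter_upwards [(memLp_testFunction φ).coeFn_toLp] with x hx
    rw [testLp, hx, mul_comm]
  have e2 : ∫ x in (U : Set Plane), partialDerivLp φ i x * ψ x
      = ∫ x in (U : Set Plane), partialDeriv i φ x * ψ x := by
    refine integral_congr_ae ?_
    filter_upwards [(memLp_partialDeriv φ i).coeFn_toLp] with x hx
    rw [partialDerivLp, hx]
  rw [e1, e2, setIntegral_mul_testFunction, setIntegral_mul_testFunction]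
  have hd : ∀ χ : 𝓓(U, ℂ), Continuous (partialDeriv i χ) := fun χ =>
    (χ.contDiff.continuous_fderiv (by simp)).clm_apply continuous_const
  have hdiff : ∀ χ : 𝓓(U, ℂ), ∀ x, DifferentiableAt ℝ χ x := fun χ x =>
    χ.contDiff.differentiable (by simp) x
  have h := integral_mul_fderiv_eq_neg_fderiv_mul_of_integrable (μ := (volume : Measure Plane))
    (f := φ) (g := ψ) (v := EuclideanSpace.single i 1)
    (((hd φ).mul ψ.continuous).integrable_of_hasCompactSupport ψ.hasCompactSupport.mul_left)
    ((φ.continuous.mul (hd ψ)).integrable_of_hasCompactSupport φ.hasCompactSupport.mul_right)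
    ((φ.continuous.mul ψ.continuous).integrable_of_hasCompactSupport φ.hasCompactSupport.mul_right)
    (fun x _ => hdiff φ x) (fun x _ => hdiff ψ x)
  exact (integral_congr_ae (.of_forall fun x => mul_comm _ _)).trans h

/-- A test function as an element of `H¹(U)`. -/
def testH1 (φ : 𝓓(U, ℂ)) : H1 U := ⟨(testLp φ, partialDerivLp φ), isWeakPartial_testLp φ⟩

theorem testH1_mem_H10 (φ : 𝓓(U, ℂ)) : testH1 φ ∈ H10 U :=
  Submodule.le_topologicalClosure _
    (Submodule.subset_span ⟨φ, (memLp_testFunction φ).coeFn_toLp⟩)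

theorem eq_testH1_of_fn_ae_eq {u : H1 U} {φ : 𝓓(U, ℂ)}
    (h : u.fn =ᵐ[volume.restrict (U : Set Plane)] φ) : u = testH1 φ :=
  H1.fn_injective (Lp.ext (h.trans (memLp_testFunction φ).coeFn_toLp.symm))

/-- To prove a closed property on `H¹₀(U)` it suffices to prove it for test functions. -/
theorem H10_induction {P : H1 U → Prop} (hP : IsClosed {u | P u})
    (h : ∀ φ : 𝓓(U, ℂ), P (testH1 φ)) {u : H1 U} (hu : u ∈ H10 U) : P u := by
  refine closure_minimal (t := {u | P u}) (fun v hv => ?_) hP hu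
  -- The test functions already form a subspace, so the span adds nothing and `P` need not be
  -- compatible with linear combinations.
  suffices ∃ φ : 𝓓(U, ℂ), v.fn =ᵐ[volume.restrict (U : Set Plane)] φ by
    obtain ⟨φ, hφ⟩ := this
    rw [eq_testH1_of_fn_ae_eq hφ]
    exact h φ
  induction hv using Submodule.span_induction with
  | mem v hv => exact hv
  | zero => exact ⟨0, Lp.coeFn_zero _ _ _⟩
  | add v w _ _ hv hw =>
    obtain ⟨φ, hφ⟩ := hv
    obtain ⟨ψ, hψ⟩ := hw
    exact ⟨φ + ψ, (Lp.coeFn_add v.fn w.fn).trans (hφ.add hψ)⟩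
  | smul c v _ hv =>
    obtain ⟨φ, hφ⟩ := hv
    exact ⟨c • φ, (Lp.coeFn_smul c v.fn).trans (hφ.const_smul c)⟩

/-- A bump at a point of `U` is a nonzero element: a continuous function vanishing a.e. on an open
set vanishes on it. -/
theorem H10_ne_bot (hU : (U : Set Plane).Nonempty) : H10 U ≠ ⊥ := by
  obtain ⟨x, hx⟩ := hU
  obtain ⟨ψ, hψU, hψc, hψ, -, hψx⟩ :=
    exists_contDiff_tsupport_subset (n := ⊤) (U.isOpen.mem_nhds hx)
  let φ : 𝓓(U, ℂ) := ofRealTestFunction hψ hψc hψU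
  intro hbot
  have h0 : testH1 φ = 0 := by simpa [hbot] using testH1_mem_H10 φ
  have h1 : (φ : Plane → ℂ) =ᵐ[volume.restrict (U : Set Plane)] 0 := by
    refine (memLp_testFunction φ).coeFn_toLp.symm.trans ?_
    rw [show (memLp_testFunction φ).toLp _ = (0 : L2 U) from congrArg H1.fn h0]
    exact Lp.coeFn_zero _ _ _
  have h2 := Measure.eqOn_open_of_ae_eq h1 U.isOpen φ.continuous.continuousOn continuousOn_const hx
  change (ψ x : ℂ) = 0 at h2
  simp [hψx] at h2

end Helmholtz

/-! ### The compactness estimate for `H¹₀(U)`. -/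

namespace Helmholtz

open ENNReal

variable {U : Opens Plane}

theorem enorm_sq_eq_lintegral (f : L2 U) :
    ‖f‖ₑ ^ 2 = ∫⁻ x in (U : Set Plane), ‖f x‖ₑ ^ 2 := by
  have h := eLpNorm_nnreal_pow_eq_lintegral (p := 2) (f := f)
    (μ := volume.restrict (U : Set Plane)) two_ne_zero
  rw [Lp.enorm_def]
  simpa using h

theorem enorm_testLp_sq (φ : 𝓓(U, ℂ)) :
    ‖testLp φ‖ₑ ^ 2 = ∫⁻ x in (U : Set Plane), ‖φ x‖ₑ ^ 2 := by
  rw [enorm_sq_eq_lintegral]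
  refine lintegral_congr_ae ?_
  filter_upwards [(memLp_testFunction φ).coeFn_toLp] with x hx
  rw [testLp, hx]

theorem enorm_partialDerivLp_sq (φ : 𝓓(U, ℂ)) (i : Fin 2) :
    ‖partialDerivLp φ i‖ₑ ^ 2 = ∫⁻ x in (U : Set Plane), ‖partialDeriv i φ x‖ₑ ^ 2 := by
  rw [enorm_sq_eq_lintegral]
  refine lintegral_congr_ae ?_
  filter_upwards [(memLp_partialDeriv φ i).coeFn_toLp] with x hx
  rw [partialDerivLp, hx]

theorem norm_fderiv_le_sum (φ : Plane → ℂ) (x : Plane) :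
    ‖fderiv ℝ φ x‖ ≤ ∑ i, ‖partialDeriv i φ x‖ := by
  refine ContinuousLinearMap.opNorm_le_bound _ (by positivity) fun h => ?_
  have h1 : h = ∑ i, h i • EuclideanSpace.single i (1 : ℝ) := by
    ext j; fin_cases j <;> simp
  conv_lhs => rw [h1, map_sum]
  rw [Finset.sum_mul]
  refine (norm_sum_le _ _).trans (Finset.sum_le_sum fun i _ => ?_)
  rw [map_smul, norm_smul, mul_comm]
  exact mul_le_mul_of_nonneg_left (PiLp.norm_apply_le h i) (norm_nonneg _)

theorem enorm_fderiv_sq_le (φ : Plane → ℂ) (x : Plane) :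
    ‖fderiv ℝ φ x‖ₑ ^ 2 ≤ 2 * ∑ i, ‖partialDeriv i φ x‖ₑ ^ 2 := by
  have h1 : ‖fderiv ℝ φ x‖ ^ 2 ≤ 2 * ∑ i, ‖partialDeriv i φ x‖ ^ 2 := by
    have h := norm_fderiv_le_sum φ x
    rw [Fin.sum_univ_two] at h ⊢
    have := pow_le_pow_left₀ (norm_nonneg _) h 2
    nlinarith [sq_nonneg (‖partialDeriv 0 φ x‖ - ‖partialDeriv 1 φ x‖)]
  have h2 := ENNReal.ofReal_le_ofReal h1
  rw [ENNReal.ofReal_mul two_pos.le, ENNReal.ofReal_sum_of_nonneg fun _ _ => by positivity] at h2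
  simpa [ENNReal.ofReal_pow, ofReal_norm] using h2

theorem lintegral_enorm_fderiv_sq_le (φ : 𝓓(U, ℂ)) :
    ∫⁻ x, ‖fderiv ℝ φ x‖ₑ ^ 2 ≤ 2 * ∑ i, ‖partialDerivLp φ i‖ₑ ^ 2 := by
  have h0 : ∀ x ∉ (U : Set Plane), fderiv ℝ φ x = 0 := fun x hx =>
    image_eq_zero_of_notMem_tsupport fun h =>
      hx (φ.tsupport_subset (tsupport_fderiv_subset ℝ h))
  calc ∫⁻ x, ‖fderiv ℝ φ x‖ₑ ^ 2
      = ∫⁻ x in (U : Set Plane), ‖fderiv ℝ φ x‖ₑ ^ 2 := by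
        rw [← lintegral_indicator U.isOpen.measurableSet]
        refine lintegral_congr fun x => ?_
        by_cases hx : x ∈ (U : Set Plane)
        · rw [Set.indicator_of_mem hx]
        · rw [Set.indicator_of_notMem hx, h0 x hx, enorm_eq_nnnorm, nnnorm_zero]; simp
    _ ≤ ∫⁻ x in (U : Set Plane), 2 * ∑ i, ‖partialDeriv i φ x‖ₑ ^ 2 :=
        lintegral_mono fun x => enorm_fderiv_sq_le φ x
    _ = 2 * ∑ i, ‖partialDerivLp φ i‖ₑ ^ 2 := by
        have hc : ∀ i, Continuous (partialDeriv i φ) := fun i =>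
          (φ.contDiff.continuous_fderiv (by simp)).clm_apply continuous_const
        rw [lintegral_const_mul' _ _ (by simp), lintegral_finsetSum]
        · simp_rw [enorm_partialDerivLp_sq]
        · exact fun i _ => ((hc i).enorm.measurable.pow_const 2)

/-- The integral over a grid cell as a functional on `L²(U)`. -/
def cellIntegral (U : Opens Plane) {ε : ℝ} (hε : 0 < ε) (k : Fin 2 → ℤ) : L2 U →L[ℂ] ℂ :=
  innerSL ℂ (indicatorConstLp 2 (measurableSet_gridCell ε k)
    ((Measure.restrict_apply_le _ _).trans_lt (volume_gridCell_lt_top hε k)).ne (1 : ℂ))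

theorem cellIntegral_testLp {ε : ℝ} (hε : 0 < ε) (k : Fin 2 → ℤ) (φ : 𝓓(U, ℂ)) :
    cellIntegral U hε k (testLp φ) = ∫ x in gridCell ε k, φ x := by
  rw [cellIntegral, innerSL_apply_apply, L2.inner_indicatorConstLp_one]
  have h1 : ∫ x in gridCell ε k, testLp φ x ∂(volume.restrict (U : Set Plane))
      = ∫ x in gridCell ε k, φ x ∂(volume.restrict (U : Set Plane)) :=
    integral_congr_ae (ae_restrict_of_ae (memLp_testFunction φ).coeFn_toLp)
  rw [h1, Measure.restrict_comm (measurableSet_gridCell ε k)]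
  exact setIntegral_eq_integral_of_forall_compl_eq_zero fun x hx =>
    image_eq_zero_of_notMem_tsupport fun h => hx (φ.tsupport_subset h)

theorem ofReal_norm_sq {F : Type*} [SeminormedAddCommGroup F] (z : F) :
    ENNReal.ofReal (‖z‖ ^ 2) = ‖z‖ₑ ^ 2 := by
  rw [ENNReal.ofReal_pow (norm_nonneg _), ofReal_norm]

/-- The compactness estimate behind the Rellich theorem: on the functions of `H¹₀(U)` on which
finitely many functionals vanish, the `L²` norm is a small multiple of the norm of the gradient. -/
theorem exists_finite_norm_fn_sq_le (hU : Bornology.IsBounded (U : Set Plane)) {ε : ℝ}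
    (hε : 0 < ε) :
    ∃ (ι : Type) (_ : Fintype ι) (l : ι → L2 U →L[ℂ] ℂ), ∀ u ∈ H10 U,
      (∀ i, l i u.fn = 0) → ‖u.fn‖ ^ 2 ≤ ε ^ 2 * ∑ i, ‖u.grad i‖ ^ 2 := by
  -- With grid width `δ = ε / 12`, the balls of radii `2δ` and `δ / 2` have volume ratio `16`, and
  -- the final constant is `16 · (2δ)² · 2 = (128 / 144) ε² ≤ ε²`.
  have hδ : 0 < ε / 12 := by positivity
  obtain ⟨K, hK⟩ := exists_finset_subset_iUnion_gridCell hδ hU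
  refine ⟨K, inferInstance, fun k => cellIntegral U hδ k, fun u hu hl => ?_⟩
  set C : ℝ := volume.real (Metric.ball (0 : Plane) (ε / 12 / 2)) with hC
  have hC0 : 0 < C := ENNReal.toReal_pos (Metric.measure_ball_pos _ _ (by positivity)).ne'
    measure_ball_lt_top.ne
  have hCv : volume (Metric.ball (0 : Plane) (ε / 12 / 2)) = ENNReal.ofReal C :=
    (ofReal_measureReal measure_ball_lt_top.ne).symm
  have hCv' : volume (Metric.ball (0 : Plane) (2 * (ε / 12))) = ENNReal.ofReal (16 * C) := by
    rw [show 2 * (ε / 12) = 4 * (ε / 12 / 2) by ring,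
      Measure.addHaar_ball_mul volume (0 : Plane) (by norm_num : (0 : ℝ) ≤ 4), hCv,
      ← ENNReal.ofReal_mul (by positivity), finrank_euclideanSpace, Fintype.card_fin]
    norm_num
  -- The cell integrals stay in the bound, so that it is a closed condition on all of `H¹₀(U)` and
  -- can be checked on test functions; their vanishing is used only afterwards.
  have key : C * ‖u.fn‖ ^ 2 ≤ ∑ k ∈ K, ‖cellIntegral U hδ k u.fn‖ ^ 2
      + 16 * C * ((2 * (ε / 12)) ^ 2 * (2 * ∑ i, ‖u.grad i‖ ^ 2)) := by
    have hfn : Continuous (H1.fn : H1 U → L2 U) := continuous_fst.comp continuous_subtype_val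
    have hgr : ∀ i, Continuous fun u : H1 U => u.grad i := fun i =>
      (continuous_apply i).comp (continuous_snd.comp continuous_subtype_val)
    refine H10_induction (P := fun u => C * ‖u.fn‖ ^ 2 ≤ ∑ k ∈ K, ‖cellIntegral U hδ k u.fn‖ ^ 2
      + 16 * C * ((2 * (ε / 12)) ^ 2 * (2 * ∑ i, ‖u.grad i‖ ^ 2)))
      (isClosed_le (by fun_prop) (by fun_prop)) (fun φ => ?_) hu
    have h := lintegral_enorm_sq_le_sum_mean_add hδ (φ.contDiff.of_le (by simp))
      (φ.continuous.memLp_of_hasCompactSupport φ.hasCompactSupport) hK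
    rw [hCv, hCv', ← enorm_testLp_sq] at h
    simp_rw [← cellIntegral_testLp hδ] at h
    replace h := h.trans (add_le_add_right (mul_le_mul_right (mul_le_mul_right
      (lintegral_enorm_fderiv_sq_le φ) _) _) _)
    rw [← ENNReal.ofReal_le_ofReal_iff (by positivity), ENNReal.ofReal_mul hC0.le,
      ENNReal.ofReal_add (by positivity) (by positivity),
      ENNReal.ofReal_sum_of_nonneg fun _ _ => by positivity,
      ENNReal.ofReal_mul (p := 16 * C) (by positivity),
      ENNReal.ofReal_mul (p := (2 * (ε / 12)) ^ 2) (by positivity),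
      ENNReal.ofReal_mul two_pos.le, ENNReal.ofReal_sum_of_nonneg fun _ _ => by positivity,
      ENNReal.ofReal_pow (p := 2 * (ε / 12)) (by positivity), ENNReal.ofReal_ofNat]
    simp_rw [ofReal_norm_sq]
    exact h
  rw [Finset.sum_eq_zero fun k hk => by
    rw [show cellIntegral U hδ k u.fn = 0 from hl ⟨k, hk⟩]; simp] at key
  have hS : 0 ≤ ∑ i, ‖u.grad i‖ ^ 2 := by positivity
  refine le_of_mul_le_mul_left (key.trans ?_) hC0
  have : 0 ≤ C * (ε ^ 2 * ∑ i, ‖u.grad i‖ ^ 2) := by positivity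
  linarith

end Helmholtz

/-! ### The operator `1 - 2 L†L` and the abstract variational problem. -/

section CompactForm

variable {V F : Type*} [NormedAddCommGroup V] [InnerProductSpace ℂ V] [CompleteSpace V]
  [NormedAddCommGroup F] [InnerProductSpace ℂ F] [CompleteSpace F]

open ContinuousLinearMap Module.End

/-- The eigenvalues of the form `⟪v, u⟫ - ⟪L v, L u⟫` relative to `⟪L v, L u⟫`. -/
def relativeEigenvalues (L : V →L[ℂ] F) : Set ℝ :=
  {μ | ∃ b : V, b ≠ 0 ∧ ∀ v, inner ℂ v b - inner ℂ (L v) (L b) = (μ : ℂ) * inner ℂ (L v) (L b)}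

/-- The smallest modulus of an eigenvalue of `1 - 2 L† L`, in terms of `relativeEigenvalues L`. -/
def spectralGap (L : V →L[ℂ] F) : ℝ :=
  ⨅ μ : relativeEigenvalues L, |(μ : ℝ) - 1| / ((μ : ℝ) + 1)

variable {L : V →L[ℂ] F}

/-- The operator `1 - 2 L† L`. -/
def oneSubTwoGram (L : V →L[ℂ] F) : V →L[ℂ] V := .id ℂ V - (2 : ℂ) • (adjoint L ∘L L)

theorem inner_oneSubTwoGram (L : V →L[ℂ] F) (v u : V) :
    inner ℂ v (oneSubTwoGram L u) = inner ℂ v u - 2 * inner ℂ (L v) (L u) := by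
  change inner ℂ v (u - (2 : ℂ) • adjoint L (L u)) = _
  rw [inner_sub_right, inner_smul_right, adjoint_inner_right]

theorem isSymmetric_adjoint_comp_self (L : V →L[ℂ] F) : (adjoint L ∘L L).IsSymmetric := by
  intro u v
  change inner ℂ (adjoint L (L u)) v = inner ℂ u (adjoint L (L v))
  rw [adjoint_inner_left, adjoint_inner_right]

/-- The weak equation says `⟪v, b⟫ = (μ + 1) ⟪v, L†L b⟫` for all `v`, that is, `b = (μ + 1) L†L b`.
-/
theorem mem_relativeEigenvalues_iff {μ : ℝ} (hμ : μ + 1 ≠ 0) :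
    μ ∈ relativeEigenvalues L ↔
      HasEigenvalue ((adjoint L ∘L L : V →L[ℂ] V) : Module.End ℂ V) ((μ : ℂ) + 1)⁻¹ := by
  have hμ' : (μ : ℂ) + 1 ≠ 0 := by exact_mod_cast hμ
  have key : ∀ b : V, (∀ v, inner ℂ v b - inner ℂ (L v) (L b) = (μ : ℂ) * inner ℂ (L v) (L b)) ↔
      adjoint L (L b) = ((μ : ℂ) + 1)⁻¹ • b := by
    intro b
    rw [eq_inv_smul_iff₀ hμ']
    constructor
    · intro h
      refine ext_inner_left ℂ fun v => ?_
      rw [inner_smul_right, adjoint_inner_right]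
      linear_combination -h v
    · intro h v
      have h2 := congrArg (inner ℂ v) h
      rw [inner_smul_right, adjoint_inner_right] at h2
      linear_combination -h2
  constructor
  · rintro ⟨b, hb, h⟩
    exact hasEigenvalue_of_hasEigenvector ⟨mem_eigenspace_iff.2 ((key b).1 h), hb⟩
  · intro h
    obtain ⟨b, hb⟩ := h.exists_hasEigenvector
    exact ⟨b, hb.2, (key b).2 hb.apply_eq_smul⟩

/-- Testing with `v = b` gives `‖b‖² = (μ + 1) ‖L b‖²`. -/
theorem relativeEigenvalues_add_one_pos {V F : Type*} [NormedAddCommGroup V]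
    [InnerProductSpace ℂ V] [NormedAddCommGroup F] [InnerProductSpace ℂ F] {L : V →L[ℂ] F}
    {μ : ℝ} (hμ : μ ∈ relativeEigenvalues L) : 0 < μ + 1 := by
  obtain ⟨b, hb, h⟩ := hμ
  have h1 := h b
  rw [inner_self_eq_norm_sq_to_K, inner_self_eq_norm_sq_to_K] at h1
  have h2 : ‖b‖ ^ 2 = (μ + 1) * ‖L b‖ ^ 2 := by
    apply Complex.ofReal_injective
    push_cast
    simp only [Complex.coe_algebraMap] at h1
    linear_combination h1
  have h3 : 0 < (μ + 1) * ‖L b‖ ^ 2 := by rw [← h2]; positivity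
  exact pos_of_mul_pos_left h3 (by positivity)

/-- Pairing with an eigenvector `b` gives `θ = ‖L b‖² / ‖b‖²`, which is nonzero because `L` is
injective; so `μ = ‖b‖² / ‖L b‖² - 1`. -/
theorem HasEigenvalue.exists_mem_relativeEigenvalues (hL : Function.Injective L) {θ : ℂ}
    (hθ : HasEigenvalue ((adjoint L ∘L L : V →L[ℂ] V) : Module.End ℂ V) θ) :
    ∃ μ ∈ relativeEigenvalues L, θ = ((μ : ℂ) + 1)⁻¹ := by
  obtain ⟨b, hb⟩ := hθ.exists_hasEigenvector
  have h1 : adjoint L (L b) = θ • b := hb.apply_eq_smul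
  have h2 : ((‖L b‖ ^ 2 : ℝ) : ℂ) = θ * ((‖b‖ ^ 2 : ℝ) : ℂ) := by
    have := congrArg (inner ℂ b) h1
    rw [adjoint_inner_right, inner_smul_right, inner_self_eq_norm_sq_to_K,
      inner_self_eq_norm_sq_to_K] at this
    push_cast
    exact this
  have hb0 : 0 < ‖b‖ ^ 2 := by have := norm_pos_iff.2 hb.2; positivity
  have hLb0 : 0 < ‖L b‖ ^ 2 := by
    have : L b ≠ 0 := fun h => hb.2 (hL (by rw [h, map_zero]))
    have := norm_pos_iff.2 this
    positivity
  have hb0' : ((‖b‖ ^ 2 : ℝ) : ℂ) ≠ 0 := by exact_mod_cast hb0.ne'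
  have hθ' : θ = (((‖b‖ ^ 2 / ‖L b‖ ^ 2 - 1 : ℝ) : ℂ) + 1)⁻¹ := by
    rw [Complex.ofReal_sub, Complex.ofReal_one, sub_add_cancel, Complex.ofReal_div, inv_div, h2,
      mul_div_cancel_right₀ _ hb0']
  refine ⟨_, ?_, hθ'⟩
  rw [mem_relativeEigenvalues_iff (by rw [sub_add_cancel]; positivity), ← hθ']
  exact hθ

theorem norm_inv_sub_half {μ : ℝ} (hμ : 0 < μ + 1) :
    ‖((μ : ℂ) + 1)⁻¹ - 1 / 2‖ = |μ - 1| / (μ + 1) / 2 := by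
  have : ((μ : ℂ) + 1)⁻¹ - 1 / 2 = (((1 - μ) / (μ + 1) / 2 : ℝ) : ℂ) := by
    have hμ' : (μ : ℂ) + 1 ≠ 0 := by exact_mod_cast hμ.ne'
    push_cast
    field_simp
    ring
  rw [this, Complex.norm_real, Real.norm_eq_abs, abs_div, abs_div, abs_of_pos hμ, abs_sub_comm,
    abs_two]

theorem spectralGap_nonneg {V F : Type*} [NormedAddCommGroup V]
    [InnerProductSpace ℂ V] [NormedAddCommGroup F] [InnerProductSpace ℂ F] {L : V →L[ℂ] F} :
    0 ≤ spectralGap L :=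
  Real.iInf_nonneg fun μ => div_nonneg (abs_nonneg _) (relativeEigenvalues_add_one_pos μ.2).le

theorem spectralGap_le {V F : Type*} [NormedAddCommGroup V]
    [InnerProductSpace ℂ V] [NormedAddCommGroup F] [InnerProductSpace ℂ F] {L : V →L[ℂ] F}
    {μ : ℝ} (hμ : μ ∈ relativeEigenvalues L) :
    spectralGap L ≤ |μ - 1| / (μ + 1) :=
  ciInf_le (f := fun μ : relativeEigenvalues L => |(μ : ℝ) - 1| / ((μ : ℝ) + 1))
    ⟨0, by
      rintro _ ⟨μ, rfl⟩
      exact div_nonneg (abs_nonneg _) (relativeEigenvalues_add_one_pos μ.2).le⟩ ⟨μ, hμ⟩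

theorem not_hasEigenvalue_half (h1 : (1 : ℝ) ∉ relativeEigenvalues L) :
    ¬ HasEigenvalue ((adjoint L ∘L L : V →L[ℂ] V) : Module.End ℂ V) (1 / 2) := by
  rw [mem_relativeEigenvalues_iff (by norm_num)] at h1
  convert h1 using 2
  norm_num

theorem spectralGap_pos [Nontrivial V] (hLc : IsCompactOperator L) (hL : Function.Injective L)
    (h1 : (1 : ℝ) ∉ relativeEigenvalues L) : 0 < spectralGap L := by
  have hTc : IsCompactOperator (adjoint L ∘L L) := hLc.clm_comp (adjoint L)
  obtain ⟨δ, hδ, h⟩ := hTc.exists_pos_le_norm_sub (by norm_num) (not_hasEigenvalue_half h1)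
  -- The real infimum over an empty set is `0`. Without eigenvalues the compact symmetric operator
  -- `L†L` would be zero, contradicting injectivity of `L` on a nontrivial space.
  have hne : Nonempty (relativeEigenvalues L) := by
    by_contra hne
    have h0 : adjoint L ∘L L = 0 := by
      rw [← eq_zero_of_forall_hasEigenvalue_eq_zero hTc (isSymmetric_adjoint_comp_self L)]
      intro θ hθ
      obtain ⟨μ, hμ, -⟩ := HasEigenvalue.exists_mem_relativeEigenvalues hL hθ
      exact absurd ⟨⟨μ, hμ⟩⟩ hne
    obtain ⟨b, hb⟩ := exists_ne (0 : V)
    refine hb (hL ?_)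
    rw [map_zero, ← inner_self_eq_zero (𝕜 := ℂ), ← adjoint_inner_right]
    rw [show adjoint L (L b) = 0 from DFunLike.congr_fun h0 b, inner_zero_right]
  refine lt_of_lt_of_le (by positivity : 0 < 2 * δ) (le_ciInf fun μ => ?_)
  have hμ := relativeEigenvalues_add_one_pos μ.2
  have := h _ ((mem_relativeEigenvalues_iff hμ.ne').1 μ.2)
  rw [norm_inv_sub_half hμ] at this
  linarith

/-- `1 - 2 L†L = -2 (L†L - 1/2)`, and the eigenvalues of `L†L` stay at distance at least half the
gap from `1/2`. -/
theorem spectralGap_mul_norm_le (hLc : IsCompactOperator L) (hL : Function.Injective L) (u : V) :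
    spectralGap L * ‖u‖ ≤ ‖oneSubTwoGram L u‖ := by
  have hTc : IsCompactOperator (adjoint L ∘L L) := hLc.clm_comp (adjoint L)
  have h := hTc.mul_norm_le_norm_sub_smul (isSymmetric_adjoint_comp_self L) (1 / 2)
    (β := spectralGap L / 2) (by linarith [spectralGap_nonneg (L := L)]) (fun θ hθ => by
      obtain ⟨μ, hμ, rfl⟩ := HasEigenvalue.exists_mem_relativeEigenvalues hL hθ
      rw [norm_inv_sub_half (relativeEigenvalues_add_one_pos hμ)]
      linarith [spectralGap_le hμ]) u
  have h2 : oneSubTwoGram L u = (-2 : ℂ) • ((adjoint L ∘L L) u - (1 / 2 : ℂ) • u) := by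
    change u - (2 : ℂ) • (adjoint L ∘L L) u = _
    module
  rw [h2, norm_smul]
  norm_num
  norm_num at h
  linarith

/-- The Fredholm alternative for `1 - 2 L† L`. -/
theorem exists_continuousLinearEquiv_sub_two_smul (hLc : IsCompactOperator L)
    (h1 : (1 : ℝ) ∉ relativeEigenvalues L) :
    ∃ S : V ≃L[ℂ] V, ∀ u, S u = oneSubTwoGram L u := by
  have hTc : IsCompactOperator (adjoint L ∘L L) := hLc.clm_comp (adjoint L)
  have h := (hTc.hasEigenvalue_or_mem_resolventSet (μ := (1 / 2 : ℂ))
    (by norm_num)).resolve_left (not_hasEigenvalue_half h1)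
  rw [spectrum.mem_resolventSet_iff, isUnit_iff_bijective] at h
  have hb : Function.Bijective (1 - (2 : ℂ) • (adjoint L ∘L L) : V →L[ℂ] V) := by
    rw [← isUnit_iff_bijective] at h ⊢
    have h2 : (1 - (2 : ℂ) • (adjoint L ∘L L) : V →L[ℂ] V)
        = algebraMap ℂ (V →L[ℂ] V) 2 * (algebraMap ℂ (V →L[ℂ] V) (1 / 2) - adjoint L ∘L L) := by
      rw [mul_sub, ← map_mul, ← Algebra.smul_def]
      norm_num
    rw [h2]
    exact (((IsUnit.mk0 (2 : ℂ) two_ne_zero).map (algebraMap ℂ (V →L[ℂ] V)))).mul h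
  refine ⟨ContinuousLinearEquiv.ofBijective _ (LinearMap.ker_eq_bot.2 hb.1)
    (LinearMap.range_eq_top.2 hb.2), fun u => rfl⟩

/-- A space `X` with a subspace `X₀`, represented by `J` in a Hilbert space `H` such that `ι`
identifies a Hilbert space `V` with the image of `X₀` and the compression of `R` to `V` is
`1 - 2 L† L`. -/
structure RestrictionModel {X H : Type*} [NormedAddCommGroup X] [NormedSpace ℂ X]
    [NormedAddCommGroup H] [InnerProductSpace ℂ H] (X₀ : Submodule ℂ X) (J : X →L[ℂ] H)
    (ι : V →ₗᵢ[ℂ] H) (B : V →L[ℂ] X) (L : V →L[ℂ] F) (R : H →L[ℂ] H) : Prop where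
  injective : Function.Injective J
  inv_mem : ∀ v, B v ∈ X₀
  map_inv : ∀ v, J (B v) = ι v
  exists_eq : ∀ u ∈ X₀, ∃ v, ι v = J u
  inner_eq : ∀ v u, inner ℂ (ι v) (R (ι u)) = inner ℂ v (oneSubTwoGram L u)
  norm_le : ∀ y, ‖R y‖ ≤ ‖y‖

namespace RestrictionModel

variable {X H : Type*} [NormedAddCommGroup X] [NormedSpace ℂ X]
  [NormedAddCommGroup H] [InnerProductSpace ℂ H] {X₀ : Submodule ℂ X}
  {J : X →L[ℂ] H} {ι : V →ₗᵢ[ℂ] H} {B : V →L[ℂ] X} {R : H →L[ℂ] H}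

theorem exists_spectralGap_le (h : RestrictionModel X₀ J ι B L R) (hLc : IsCompactOperator L)
    (hL : Function.Injective L) (hβ : 0 < spectralGap L) {u : X} (hu : u ∈ X₀) (hu0 : u ≠ 0) :
    ∃ v ∈ X₀, v ≠ 0 ∧ spectralGap L ≤ ‖(inner ℂ (J v) (R (J u)) : ℂ)‖ / (‖J u‖ * ‖J v‖) := by
  obtain ⟨w, hw⟩ := h.exists_eq u hu
  have hs := spectralGap_mul_norm_le hLc hL w
  set s := oneSubTwoGram L w with hsdef
  have hw0 : 0 < ‖w‖ := norm_pos_iff.2 fun h0 => hu0 (h.injective (by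
    rw [map_zero, ← hw, h0, map_zero]))
  have hs0 : 0 < ‖s‖ := (mul_pos hβ hw0).trans_le hs
  -- The test vector `s = S w` turns the quotient into `‖s‖² / (‖w‖ ‖s‖) = ‖s‖ / ‖w‖`.
  refine ⟨B s, h.inv_mem s, fun h0 => hs0.ne' ?_, ?_⟩
  · rw [← ι.norm_map, ← h.map_inv, h0, map_zero, norm_zero]
  · rw [h.map_inv, ← hw, h.inner_eq, ← hsdef, ι.norm_map, ι.norm_map, inner_self_eq_norm_sq_to_K,
      norm_pow, RCLike.norm_ofReal, abs_norm, le_div_iff₀ (by positivity)]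
    nlinarith

/-- Tested against `X₀`, the equation becomes `S w = -Pr (R (J t))` in `V`, where `Pr = ι†` and `R`
do not increase norms. Inverting `S` gives existence, uniqueness and the bound. -/
theorem exists_correction [CompleteSpace H] (h : RestrictionModel X₀ J ι B L R)
    (hLc : IsCompactOperator L) (hL : Function.Injective L) (h1 : (1 : ℝ) ∉ relativeEigenvalues L)
    (hβ : 0 < spectralGap L) :
    ∃ W : X →L[ℂ] X,
      (∀ t w, (w ∈ X₀ ∧ ∀ v ∈ X₀, inner ℂ (J v) (R (J w)) = -inner ℂ (J v) (R (J t))) ↔ w = W t) ∧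
      ∀ t, ‖J (W t)‖ ≤ 1 / spectralGap L * ‖J t‖ := by
  obtain ⟨S, hS⟩ := exists_continuousLinearEquiv_sub_two_smul hLc h1
  let Pr : H →L[ℂ] V := adjoint ι.toContinuousLinearMap
  have hPr : ∀ (v : V) (y : H), inner ℂ (ι v) y = inner ℂ v (Pr y) := fun v y =>
    (adjoint_inner_right ι.toContinuousLinearMap v y).symm
  have hPrn : ∀ y, ‖Pr y‖ ≤ ‖y‖ := fun y => by
    refine (Pr.le_opNorm y).trans (mul_le_of_le_one_left (norm_nonneg _) ?_)
    rw [LinearIsometryEquiv.norm_map]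
    exact ι.norm_toContinuousLinearMap_le
  let w : X →L[ℂ] V := -((S.symm : V →L[ℂ] V) ∘L Pr ∘L R ∘L J)
  have hSw : ∀ t, oneSubTwoGram L (w t) = -Pr (R (J t)) := fun t => by
    rw [← hS]
    change S (-S.symm (Pr (R (J t)))) = _
    rw [map_neg, S.apply_symm_apply]
  refine ⟨B ∘L w, fun t z => ⟨?_, ?_⟩, fun t => ?_⟩
  · rintro ⟨hz, hzv⟩
    obtain ⟨y, hy⟩ := h.exists_eq z hz
    have hyw : y = w t := by
      refine S.injective (ext_inner_left ℂ fun v => ?_)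
      have h2 := hzv _ (h.inv_mem v)
      rw [h.map_inv, ← hy, h.inner_eq, hPr, ← inner_neg_right, ← hSw] at h2
      rw [hS, hS, h2]
    refine h.injective ?_
    rw [← hy, hyw, coe_comp, Function.comp_apply, h.map_inv]
  · rintro rfl
    refine ⟨h.inv_mem _, fun v hv => ?_⟩
    obtain ⟨y, hy⟩ := h.exists_eq v hv
    rw [coe_comp, Function.comp_apply, h.map_inv, ← hy, h.inner_eq, hSw, hPr, inner_neg_right]
  · rw [coe_comp, Function.comp_apply, h.map_inv, ι.norm_map, one_div, inv_mul_eq_div,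
      le_div_iff₀ hβ, mul_comm]
    refine (spectralGap_mul_norm_le hLc hL (w t)).trans ?_
    rw [hSw, norm_neg]
    exact (hPrn _).trans (h.norm_le _)

end RestrictionModel

end CompactForm

/-! ### Multiplication by the weights. -/

section Multiplication

open ENNReal ContinuousLinearMap

/-- Multiplication by a real function that is bounded from above and from below by positive
constants is an isomorphism of `L²`. -/
theorem exists_continuousLinearEquiv_mul {α : Type*} [MeasurableSpace α] {μ : Measure α}
    {g : α → ℝ} (hg : AEMeasurable g μ) {m M : ℝ} (hm : 0 < m)
    (h : ∀ᵐ x ∂μ, m ≤ g x ∧ g x ≤ M) :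
    ∃ P : Lp ℂ 2 μ ≃L[ℂ] Lp ℂ 2 μ, ∀ f, P f =ᵐ[μ] fun x => (g x : ℂ) * f x := by
  have h1 : MemLp (fun x => (g x : ℂ)) ∞ μ := by
    refine memLp_top_of_bound (by fun_prop) M ?_
    filter_upwards [h] with x hx
    rw [Complex.norm_real, Real.norm_eq_abs, abs_of_pos (hm.trans_le hx.1)]
    exact hx.2
  have h2 : MemLp (fun x => ((g x)⁻¹ : ℂ)) ∞ μ := by
    refine memLp_top_of_bound (by fun_prop) m⁻¹ ?_
    filter_upwards [h] with x hx
    rw [norm_inv, Complex.norm_real, Real.norm_eq_abs, abs_of_pos (hm.trans_le hx.1)]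
    exact inv_anti₀ hm hx.1
  let B := ContinuousLinearMap.mul ℂ ℂ
  have hP : ∀ f, B.holderL μ ∞ 2 2 (h1.toLp _) f =ᵐ[μ] fun x => (g x : ℂ) * f x := fun f => by
    filter_upwards [B.coeFn_holder (r := 2) (h1.toLp _) f, h1.coeFn_toLp] with x hx hx'
    exact hx.trans (by rw [hx']; rfl)
  have hQ : ∀ f, B.holderL μ ∞ 2 2 (h2.toLp _) f =ᵐ[μ] fun x => ((g x)⁻¹ : ℂ) * f x := fun f => by
    filter_upwards [B.coeFn_holder (r := 2) (h2.toLp _) f, h2.coeFn_toLp] with x hx hx'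
    exact hx.trans (by rw [hx']; rfl)
  refine ⟨ContinuousLinearEquiv.equivOfInverse (B.holderL μ ∞ 2 2 (h1.toLp _))
    (B.holderL μ ∞ 2 2 (h2.toLp _)) (fun f => Lp.ext ?_) (fun f => Lp.ext ?_), hP⟩
  · filter_upwards [hP f, hQ (B.holderL μ ∞ 2 2 (h1.toLp _) f), h] with x h3 h4 h5
    rw [h4, h3, inv_mul_cancel_left₀ (by exact_mod_cast (hm.trans_le h5.1).ne')]
  · filter_upwards [hQ f, hP (B.holderL μ ∞ 2 2 (h2.toLp _) f), h] with x h3 h4 h5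
    rw [h4, h3, mul_inv_cancel_left₀ (by exact_mod_cast (hm.trans_le h5.1).ne')]

end Multiplication

/-- The bookkeeping of constants for the Rellich theorem; the `+ 1` keeps the denominator positive
when `c * d = 0`. -/
theorem le_mul_of_sq_le_sum_sq {ι : Type*} [Fintype ι] {c d ε N x y : ℝ} {g q : ι → ℝ}
    (hc : 0 ≤ c) (hd : 0 ≤ d) (hε : 0 ≤ ε) (hN : 0 ≤ N) (hx : x ≤ c * y)
    (hy : y ^ 2 ≤ (ε / (c * d + 1)) ^ 2 * ∑ i, g i ^ 2) (hg : ∀ i, g i ^ 2 ≤ d ^ 2 * q i ^ 2)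
    (hq : ∑ i, q i ^ 2 ≤ N ^ 2) : x ≤ ε * N := by
  have h5 : y ≤ ε / (c * d + 1) * d * N := by
    refine le_of_sq_le_sq ?_ (by positivity)
    calc y ^ 2 ≤ (ε / (c * d + 1)) ^ 2 * ∑ i, g i ^ 2 := hy
      _ ≤ (ε / (c * d + 1)) ^ 2 * ∑ i, d ^ 2 * q i ^ 2 := by
          gcongr with i; exact hg i
      _ ≤ (ε / (c * d + 1)) ^ 2 * (d ^ 2 * N ^ 2) := by
          rw [← Finset.mul_sum]; gcongr
      _ = _ := by ring
  have h6 : c * (ε / (c * d + 1) * d) ≤ ε := by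
    rw [div_mul_eq_mul_div, ← mul_div_assoc, div_le_iff₀ (by positivity)]
    nlinarith
  calc x ≤ c * (ε / (c * d + 1) * d * N) := hx.trans (by gcongr)
    _ = c * (ε / (c * d + 1) * d) * N := by ring
    _ ≤ _ := by gcongr

/-! ### The energy embedding and the Rellich theorem. -/

namespace Helmholtz

open ENNReal ContinuousLinearMap

variable {U : Opens Plane}

theorem continuous_setIntegral_mul {ψ : Plane → ℂ}
    (hψ : MemLp ψ 2 (volume.restrict (U : Set Plane))) :
    Continuous fun f : L2 U => ∫ x in (U : Set Plane), f x * ψ x := by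
  have h : ∀ f : L2 U, ∫ x in (U : Set Plane), f x * ψ x = inner ℂ (hψ.star.toLp _) f := by
    intro f
    rw [L2.inner_def]
    refine integral_congr_ae ?_
    filter_upwards [hψ.star.coeFn_toLp] with x hx
    rw [hx]
    simp
  simp_rw [h]
  fun_prop

/-- Each test function imposes a condition that is continuous in the pair. Closedness makes the
image of `H¹₀(U)` complete. -/
theorem isClosed_sobolevH1 (U : Opens Plane) :
    IsClosed (sobolevH1 U : Set (L2 U × (Fin 2 → L2 U))) := by
  have : (sobolevH1 U : Set (L2 U × (Fin 2 → L2 U))) = ⋂ (i : Fin 2) (φ : 𝓓(U, ℂ)),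
      {w | ∫ x in (U : Set Plane), w.1 x * partialDeriv i φ x
        = -∫ x in (U : Set Plane), w.2 i x * φ x} := by
    ext w
    simp [sobolevH1, IsWeakPartial]
  rw [this]
  refine isClosed_iInter fun i => isClosed_iInter fun φ => isClosed_eq ?_ ?_
  · exact (continuous_setIntegral_mul (memLp_partialDeriv φ i)).comp continuous_fst
  · exact ((continuous_setIntegral_mul (memLp_testFunction φ)).comp
      ((continuous_apply i).comp continuous_snd)).neg

/-- The Hilbert space of pairs of a function and a vector field in `L²(U)`. -/
abbrev GradHilbert (U : Opens Plane) : Type := WithLp 2 (L2 U × PiLp 2 fun _ : Fin 2 => L2 U)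

section Energy

variable (P Q : L2 U ≃L[ℂ] L2 U)

/-- The weighted pair `(u, g) ↦ (P u, Q g)`. -/
def weightEquiv : (L2 U × (Fin 2 → L2 U)) ≃L[ℂ] GradHilbert U :=
  (P.prodCongr ((ContinuousLinearEquiv.piCongrRight fun _ => Q).trans
    (PiLp.continuousLinearEquiv 2 ℂ fun _ : Fin 2 => L2 U).symm)).trans
    (WithLp.prodContinuousLinearEquiv 2 ℂ _ _).symm

/-- The map `u ↦ (P u, Q ∇u)` on `H¹(U)`. -/
def energyMap : H1 U →L[ℂ] GradHilbert U :=
  (weightEquiv P Q : (L2 U × (Fin 2 → L2 U)) →L[ℂ] GradHilbert U) ∘L (sobolevH1 U).subtypeL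

theorem energyMap_fst (u : H1 U) : (energyMap P Q u).fst = P u.fn := rfl

theorem energyMap_snd (u : H1 U) (i : Fin 2) : (energyMap P Q u).snd i = Q (u.grad i) := rfl

theorem energyMap_injective : Function.Injective (energyMap P Q) :=
  (weightEquiv P Q).injective.comp Subtype.val_injective

theorem isClosedEmbedding_energyMap : Topology.IsClosedEmbedding (energyMap P Q) :=
  (weightEquiv P Q).toHomeomorph.isClosedEmbedding.comp
    (isClosed_sobolevH1 U).isClosedEmbedding_subtypeVal

/-- The image of `H¹₀(U)` under `energyMap`. -/
def energyH10 : Submodule ℂ (GradHilbert U) :=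
  (H10 U).map (energyMap P Q : H1 U →ₗ[ℂ] GradHilbert U)

instance : CompleteSpace (energyH10 P Q) := by
  have h : IsClosed (energyH10 P Q : Set (GradHilbert U)) :=
    (isClosedEmbedding_energyMap P Q).isClosedMap _ (Submodule.isClosed_topologicalClosure _)
  exact h.completeSpace_coe

variable {P Q} in
theorem energyMap_mem {u : H1 U} (hu : u ∈ H10 U) : energyMap P Q u ∈ energyH10 P Q :=
  Submodule.mem_map_of_mem hu

/-- The inverse of `energyMap` on the image of `H¹₀(U)`. -/
def energyInv : energyH10 P Q →L[ℂ] H1 U :=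
  (((weightEquiv P Q).symm : GradHilbert U →L[ℂ] (L2 U × (Fin 2 → L2 U))) ∘L
    (energyH10 P Q).subtypeL).codRestrict (sobolevH1 U) (by
      rintro ⟨_, u, -, rfl⟩
      change (weightEquiv P Q).symm (weightEquiv P Q u.1) ∈ sobolevH1 U
      rw [ContinuousLinearEquiv.symm_apply_apply]
      exact u.2)

theorem energyMap_energyInv (v : energyH10 P Q) : energyMap P Q (energyInv P Q v) = v :=
  (weightEquiv P Q).apply_symm_apply _

theorem energyInv_mem (v : energyH10 P Q) : energyInv P Q v ∈ H10 U := by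
  obtain ⟨u, hu, h⟩ := v.2
  have : energyInv P Q v = u :=
    energyMap_injective P Q ((energyMap_energyInv P Q v).trans h.symm)
  rwa [this]

/-- The first component on the image of `H¹₀(U)`. -/
def energyFst : energyH10 P Q →L[ℂ] L2 U := WithLp.fstL 2 ℂ _ _ ∘L (energyH10 P Q).subtypeL

theorem energyFst_injective : Function.Injective (energyFst P Q) := by
  rintro ⟨_, u, hu, rfl⟩ ⟨_, v, hv, rfl⟩ h
  have h1 : P u.fn = P v.fn := h
  have h2 : u = v := H1.fn_injective (P.injective h1)
  exact Subtype.ext (congrArg (energyMap P Q) h2)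

/-- The Rellich theorem: the embedding of `H¹₀(U)` into `L²(U)` is compact. -/
theorem isCompactOperator_energyFst (hU : Bornology.IsBounded (U : Set Plane)) :
    IsCompactOperator (energyFst P Q) := by
  refine isCompactOperator_of_forall_exists_finite (V := energyH10 P Q) (F := L2 U)
    (energyFst P Q) fun ε hε => ?_
  set c : ℝ := ‖(P : L2 U →L[ℂ] L2 U)‖ with hc
  set d : ℝ := ‖(Q.symm : L2 U →L[ℂ] L2 U)‖ with hd
  have hc0 : 0 ≤ c := norm_nonneg _
  have hd0 : 0 ≤ d := norm_nonneg _
  obtain ⟨ι, hι, l, hl⟩ := exists_finite_norm_fn_sq_le hU (ε := ε / (c * d + 1)) (by positivity)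
  -- The first component is `P u`, so the functionals of `u` are composed with `P⁻¹`.
  refine ⟨ι, hι, fun i => l i ∘L (P.symm : L2 U →L[ℂ] L2 U) ∘L energyFst P Q, ?_⟩
  rintro ⟨_, u, hu, rfl⟩ h0
  have h1 := hl u hu fun i => by
    have := h0 i
    change l i (P.symm (P u.fn)) = 0 at this
    rwa [P.symm_apply_apply] at this
  change ‖P u.fn‖ ≤ ε * ‖energyMap P Q u‖
  have h2 : ‖P u.fn‖ ≤ c * ‖u.fn‖ := (P : L2 U →L[ℂ] L2 U).le_opNorm _
  have h3 : ∀ i, ‖u.grad i‖ ^ 2 ≤ d ^ 2 * ‖Q (u.grad i)‖ ^ 2 := fun i => by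
    have := (Q.symm : L2 U →L[ℂ] L2 U).le_opNorm (Q (u.grad i))
    rw [ContinuousLinearEquiv.coe_coe, Q.symm_apply_apply] at this
    rw [← mul_pow]
    exact pow_le_pow_left₀ (norm_nonneg _) this 2
  have h4 : ∑ i, ‖Q (u.grad i)‖ ^ 2 ≤ ‖energyMap P Q u‖ ^ 2 := by
    rw [WithLp.prod_norm_sq_eq_of_L2, PiLp.norm_sq_eq_of_L2]
    simp_rw [energyMap_snd]
    exact le_add_of_nonneg_left (by positivity)
  exact le_mul_of_sq_le_sum_sq hc0 hd0 hε.le (norm_nonneg _) h2 h1 h3 h4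

end Energy

theorem nontrivial_energyH10 (hU : (U : Set Plane).Nonempty) (P Q : L2 U ≃L[ℂ] L2 U) :
    Nontrivial (energyH10 P Q) := by
  obtain ⟨u, hu, hu0⟩ := (Submodule.ne_bot_iff _).1 (H10_ne_bot hU)
  refine ⟨⟨⟨_, energyMap_mem hu⟩, 0, fun h => hu0 (energyMap_injective P Q ?_)⟩⟩
  rw [map_zero]
  exact congrArg Subtype.val h

end Helmholtz

/-! ### The Helmholtz form as a reflection. -/

namespace Helmholtz

open ENNReal ContinuousLinearMap

variable {U : Opens Plane}

/-- The reflection `(u, g) ↦ (-u, g)`. -/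
def reflectFst (U : Opens Plane) : GradHilbert U →L[ℂ] GradHilbert U :=
  ((WithLp.prodContinuousLinearEquiv 2 ℂ (L2 U) (PiLp 2 fun _ : Fin 2 => L2 U)).symm :
    _ →L[ℂ] GradHilbert U) ∘L ((-WithLp.fstL 2 ℂ _ _).prod (WithLp.sndL 2 ℂ _ _))

theorem norm_reflectFst (y : GradHilbert U) : ‖reflectFst U y‖ = ‖y‖ := by
  have h1 : (reflectFst U y).fst = -y.fst := rfl
  have h2 : (reflectFst U y).snd = y.snd := rfl
  rw [← sq_eq_sq₀ (norm_nonneg _) (norm_nonneg _), WithLp.prod_norm_sq_eq_of_L2,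
    WithLp.prod_norm_sq_eq_of_L2, h1, h2, norm_neg]

theorem inner_reflectFst (x y : GradHilbert U) :
    inner ℂ x (reflectFst U y) = inner ℂ x.snd y.snd - inner ℂ x.fst y.fst := by
  have h1 : (reflectFst U y).fst = -y.fst := rfl
  have h2 : (reflectFst U y).snd = y.snd := rfl
  have h := WithLp.prod_inner_apply (𝕜 := ℂ) x (reflectFst U y)
  rw [WithLp.ofLp_fst, WithLp.ofLp_fst, WithLp.ofLp_snd, WithLp.ofLp_snd, h1, h2,
    inner_neg_right] at h
  rw [h]; ring

section Forms

variable {P Q : L2 U ≃L[ℂ] L2 U} {a κ : Plane → ℝ}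

theorem massForm_eq_inner
    (hP : ∀ f, P f =ᵐ[volume.restrict (U : Set Plane)] fun x => (κ x : ℂ) * f x) (u v : H1 U) :
    massForm U κ u v = inner ℂ (energyMap P Q v).fst (energyMap P Q u).fst := by
  rw [energyMap_fst, energyMap_fst, L2.inner_def]
  refine integral_congr_ae ?_
  filter_upwards [hP u.fn, hP v.fn] with x h1 h2
  rw [h1, h2, RCLike.inner_apply, map_mul, Complex.conj_ofReal]
  ring

theorem diffForm_eq_inner
    (hQ : ∀ f, Q f =ᵐ[volume.restrict (U : Set Plane)] fun x => (√(a x) : ℂ) * f x)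
    (ha : ∀ᵐ x ∂volume.restrict (U : Set Plane), 0 ≤ a x) (u v : H1 U) :
    diffForm U a u v = inner ℂ (energyMap P Q v).snd (energyMap P Q u).snd := by
  rw [PiLp.inner_apply]
  simp_rw [energyMap_snd, L2.inner_def]
  rw [← integral_finsetSum _ fun i _ => L2.integrable_inner _ _]
  refine integral_congr_ae ?_
  filter_upwards [hQ (u.grad 0), hQ (u.grad 1), hQ (v.grad 0), hQ (v.grad 1), ha]
    with x h1 h2 h3 h4 h5
  have h6 : (√(a x) : ℂ) * √(a x) = a x := by exact_mod_cast Real.mul_self_sqrt h5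
  rw [Fin.sum_univ_two, Fin.sum_univ_two, h1, h2, h3, h4]
  simp only [RCLike.inner_apply, map_mul, Complex.conj_ofReal]
  rw [← h6]
  ring

/-- The forms `𝒜` and `(κ² ·, ·)` are represented by `energyMap P Q`. -/
def Represents (P Q : L2 U ≃L[ℂ] L2 U) (a κ : Plane → ℝ) : Prop :=
  ∀ u v : H1 U, massForm U κ u v = inner ℂ (energyMap P Q v).fst (energyMap P Q u).fst ∧
    diffForm U a u v = inner ℂ (energyMap P Q v).snd (energyMap P Q u).snd

namespace Represents

variable (h : Represents P Q a κ)

include h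

theorem helmholtzForm_eq (u v : H1 U) :
    helmholtzForm U a κ u v = inner ℂ (energyMap P Q v) (reflectFst U (energyMap P Q u)) := by
  rw [inner_reflectFst, helmholtzForm, (h u v).1, (h u v).2]

theorem diffForm_add_massForm (u v : H1 U) :
    diffForm U a u v + massForm U κ u v = inner ℂ (energyMap P Q v) (energyMap P Q u) := by
  rw [(h u v).1, (h u v).2, WithLp.prod_inner_apply, add_comm]
  rfl

theorem energyNorm_eq (u : H1 U) : energyNorm U a κ u = ‖energyMap P Q u‖ := by
  rw [energyNorm, h.diffForm_add_massForm, norm_eq_sqrt_re_inner (𝕜 := ℂ)]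
  rfl

/-- The form is Hermitian; this transfers the inf-sup bound to the other argument. -/
theorem norm_helmholtzForm_comm (u v : H1 U) :
    ‖helmholtzForm U a κ u v‖ = ‖helmholtzForm U a κ v u‖ := by
  rw [h.helmholtzForm_eq, h.helmholtzForm_eq, inner_reflectFst, inner_reflectFst,
    ← RCLike.norm_conj, map_sub, inner_conj_symm, inner_conj_symm]

theorem norm_helmholtzForm_le (u v : H1 U) :
    ‖helmholtzForm U a κ u v‖ ≤ ‖energyMap P Q u‖ * ‖energyMap P Q v‖ := by
  rw [h.helmholtzForm_eq, mul_comm, ← norm_reflectFst (energyMap P Q u)]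
  exact norm_inner_le_norm _ _

theorem dirichletEigenvalues_eq :
    dirichletEigenvalues U a κ =
      relativeEigenvalues (V := energyH10 P Q) (F := L2 U) (energyFst P Q) := by
  have key : ∀ (μ : ℝ) (b v : H1 U), diffForm U a b v = (μ : ℂ) * massForm U κ b v ↔
      inner ℂ (energyMap P Q v) (energyMap P Q b)
        - inner ℂ (energyMap P Q v).fst (energyMap P Q b).fst
        = (μ : ℂ) * inner ℂ (energyMap P Q v).fst (energyMap P Q b).fst := by
    intro μ b v
    rw [← h.diffForm_add_massForm, ← (h b v).1, add_sub_cancel_right]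
  ext μ
  constructor
  · rintro ⟨b, hb, hb0, hbv⟩
    refine ⟨⟨_, energyMap_mem hb⟩, fun h0 => hb0 (energyMap_injective P Q ?_), ?_⟩
    · rw [map_zero]
      exact congrArg Subtype.val h0
    · rintro ⟨_, v, hv, rfl⟩
      exact (key μ b v).1 (hbv v hv)
  · rintro ⟨⟨_, b, hb, rfl⟩, hb0, hbv⟩
    refine ⟨b, hb, fun h0 => hb0 (Subtype.ext ?_), fun v hv => ?_⟩
    · exact (congrArg (energyMap P Q) h0).trans (map_zero _)
    · exact (key μ b v).2 (hbv ⟨_, energyMap_mem hv⟩)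

theorem infSupConst_eq :
    infSupConst U a κ = spectralGap (V := energyH10 P Q) (F := L2 U) (energyFst P Q) := by
  rw [infSupConst, spectralGap, h.dirichletEigenvalues_eq]

end Represents

end Forms

variable {P Q : L2 U ≃L[ℂ] L2 U} {a κ : Plane → ℝ}

/-- The reflected product is the full inner product minus twice its first-component part, which is
`⟪L v, L u⟫`. -/
theorem inner_reflectFst_coe (v u : energyH10 P Q) :
    inner ℂ (v : GradHilbert U) (reflectFst U u)
      = inner ℂ v (oneSubTwoGram (V := energyH10 P Q) (F := L2 U) (energyFst P Q) u) := by
  rw [inner_oneSubTwoGram, inner_reflectFst, Submodule.coe_inner, WithLp.prod_inner_apply]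
  change _ = _ - 2 * inner ℂ (v : GradHilbert U).fst (u : GradHilbert U).fst
  change _ = inner ℂ (v : GradHilbert U).fst (u : GradHilbert U).fst
    + inner ℂ (v : GradHilbert U).snd (u : GradHilbert U).snd - _
  ring

theorem restrictionModel (P Q : L2 U ≃L[ℂ] L2 U) :
    RestrictionModel (V := energyH10 P Q) (F := L2 U) (H10 U) (energyMap P Q)
      (energyH10 P Q).subtypeₗᵢ (energyInv P Q) (energyFst P Q) (reflectFst U) where
  injective := energyMap_injective P Q
  inv_mem := energyInv_mem P Q
  map_inv := energyMap_energyInv P Q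
  exists_eq _ hu := ⟨⟨_, energyMap_mem hu⟩, rfl⟩
  inner_eq := inner_reflectFst_coe
  norm_le y := (norm_reflectFst y).le

namespace Represents

variable (h : Represents P Q a κ) (hU : Bornology.IsBounded (U : Set Plane))

include h hU

/-- The inf-sup condition for a fixed first argument. -/
theorem exists_infSupConst_le (hβ : 0 < infSupConst U a κ) {u : H1 U} (hu : u ∈ H10 U)
    (hu0 : u ≠ 0) : ∃ v ∈ H10 U, v ≠ 0 ∧ infSupConst U a κ ≤
      ‖helmholtzForm U a κ u v‖ / (energyNorm U a κ u * energyNorm U a κ v) := by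
  rw [h.infSupConst_eq] at hβ ⊢
  obtain ⟨v, hv, hv0, hle⟩ := (restrictionModel P Q).exists_spectralGap_le
    (isCompactOperator_energyFst P Q hU) (energyFst_injective P Q) hβ hu hu0
  refine ⟨v, hv, hv0, ?_⟩
  rwa [h.helmholtzForm_eq, h.energyNorm_eq, h.energyNorm_eq]

theorem exists_correction (h1 : (1 : ℝ) ∉ dirichletEigenvalues U a κ)
    (hβ : 0 < infSupConst U a κ) :
    ∃ W : H1 U →L[ℂ] H1 U, (∀ t w, IsCorrection U a κ t w ↔ w = W t) ∧
      ∀ t, energyNorm U a κ (W t) ≤ 1 / infSupConst U a κ * energyNorm U a κ t := by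
  rw [h.dirichletEigenvalues_eq] at h1
  rw [h.infSupConst_eq] at hβ ⊢
  obtain ⟨W, hW, hWn⟩ := (restrictionModel P Q).exists_correction
    (isCompactOperator_energyFst P Q hU) (energyFst_injective P Q) h1 hβ
  refine ⟨W, fun t w => ?_, fun t => ?_⟩
  · rw [← hW, IsCorrection]
    simp only [h.helmholtzForm_eq]
  · rw [h.energyNorm_eq, h.energyNorm_eq]
    exact hWn t

end Represents

/-- Weights for which the forms are represented. -/
theorem exists_represents {a κ : Plane → ℝ} {amin amax kmin kmax : ℝ} (hamin : 0 < amin)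
    (hkmin : 0 < kmin) (ha_meas : AEMeasurable a (volume.restrict (U : Set Plane)))
    (hk_meas : AEMeasurable κ (volume.restrict (U : Set Plane)))
    (ha : ∀ᵐ x ∂(volume.restrict (U : Set Plane)), amin ≤ a x ∧ a x ≤ amax)
    (hk : ∀ᵐ x ∂(volume.restrict (U : Set Plane)), kmin ≤ κ x ∧ κ x ≤ kmax) :
    ∃ P Q : L2 U ≃L[ℂ] L2 U, Represents P Q a κ := by
  obtain ⟨P, hP⟩ := exists_continuousLinearEquiv_mul hk_meas hkmin hk
  obtain ⟨Q, hQ⟩ := exists_continuousLinearEquiv_mul (g := fun x => √(a x)) ha_meas.sqrt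
    (Real.sqrt_pos.2 hamin) (M := √amax) (ha.mono fun x hx =>
      ⟨Real.sqrt_le_sqrt hx.1, Real.sqrt_le_sqrt hx.2⟩)
  exact ⟨P, Q, fun u v => ⟨massForm_eq_inner hP u v,
    diffForm_eq_inner hQ (ha.mono fun x hx => hamin.le.trans hx.1) u v⟩⟩

end Helmholtz

end

/-! ### The main theorem. -/

theorem mainTheorem8
    (U : Opens Helmholtz.Plane) (hU_ne : (U : Set Helmholtz.Plane).Nonempty)
    (hU_bdd : Bornology.IsBounded (U : Set Helmholtz.Plane))
    (a c : Helmholtz.Plane → ℝ) (ω amin amax cmin cmax : ℝ)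
    (hω : 0 < ω) (hamin : 0 < amin) (hcmin : 0 < cmin)
    (ha_meas : AEMeasurable a (volume.restrict (U : Set Helmholtz.Plane)))
    (hc_meas : AEMeasurable c (volume.restrict (U : Set Helmholtz.Plane)))
    (ha : ∀ᵐ x ∂(volume.restrict (U : Set Helmholtz.Plane)), amin ≤ a x ∧ a x ≤ amax)
    (hc : ∀ᵐ x ∂(volume.restrict (U : Set Helmholtz.Plane)), cmin ≤ c x ∧ c x ≤ cmax)
    (κ : Helmholtz.Plane → ℝ) (hκ : κ = fun x => ω / c x)
    (h_eig : ∀ μ ∈ Helmholtz.dirichletEigenvalues U a κ, μ ≠ 1) :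
    -- the constant is positive
    0 < Helmholtz.infSupConst U a κ ∧
    -- the inf-sup condition, with the infimum over the first argument
    (Helmholtz.infSupConst U a κ ≤
      ⨅ u : {u : Helmholtz.H10 U // u ≠ 0}, ⨆ v : {v : Helmholtz.H10 U // v ≠ 0},
        ‖Helmholtz.helmholtzForm U a κ u.1 v.1‖ /
          (Helmholtz.energyNorm U a κ u.1 * Helmholtz.energyNorm U a κ v.1)) ∧
    -- the inf-sup condition, with the infimum over the second argument
    (Helmholtz.infSupConst U a κ ≤
      ⨅ v : {v : Helmholtz.H10 U // v ≠ 0}, ⨆ u : {u : Helmholtz.H10 U // u ≠ 0},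
        ‖Helmholtz.helmholtzForm U a κ u.1 v.1‖ /
          (Helmholtz.energyNorm U a κ u.1 * Helmholtz.energyNorm U a κ v.1)) ∧
    -- unique solvability of the local problems that define the extension
    (∀ t : Helmholtz.H1 U, ∃! t₀ : Helmholtz.H1 U, Helmholtz.IsCorrection U a κ t t₀) ∧
    -- the extension operator exists, is unique, linear and continuous, and obeys the bound
    (∃ E : Helmholtz.TraceSpace U →L[ℂ] Helmholtz.H1 U,
      Helmholtz.IsHelmholtzExtension U a κ E ∧
      (∀ E' : Helmholtz.TraceSpace U → Helmholtz.H1 U,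
        Helmholtz.IsHelmholtzExtension U a κ E' → E' = E) ∧
      ∀ (τ : Helmholtz.TraceSpace U) (t : Helmholtz.H1 U), Helmholtz.trace t = τ →
        Helmholtz.energyNorm U a κ (E τ) ≤
          (1 + 1 / Helmholtz.infSupConst U a κ) * Helmholtz.energyNorm U a κ t) := by
  
  -- Positivity of `cmax` is not among the hypotheses; `max cmax cmin` is positive and still bounds
  -- `c`.
  have hk : ∀ᵐ x ∂(volume.restrict (U : Set Helmholtz.Plane)),
      ω / max cmax cmin ≤ κ x ∧ κ x ≤ ω / cmin := by
    filter_upwards [hc] with x hx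
    have hcx : 0 < c x := hcmin.trans_le hx.1
    rw [hκ]
    exact ⟨div_le_div_of_nonneg_left hω.le hcx (hx.2.trans (le_max_left _ _)),
      div_le_div_of_nonneg_left hω.le hcmin hx.1⟩
  have hk_meas : AEMeasurable κ (volume.restrict (U : Set Helmholtz.Plane)) := by
    rw [hκ]
    exact hc_meas.const_div ω
  obtain ⟨P, Q, h⟩ := Helmholtz.exists_represents hamin
    (div_pos hω (hcmin.trans_le (le_max_right _ _))) ha_meas hk_meas ha hk
  have h1 : (1 : ℝ) ∉ Helmholtz.dirichletEigenvalues U a κ := fun h' => h_eig 1 h' rfl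
  have hβ : 0 < Helmholtz.infSupConst U a κ := by
    have := Helmholtz.nontrivial_energyH10 hU_ne P Q
    rw [h.infSupConst_eq]
    exact spectralGap_pos (Helmholtz.isCompactOperator_energyFst P Q hU_bdd)
      (Helmholtz.energyFst_injective P Q) (h.dirichletEigenvalues_eq ▸ h1)
  obtain ⟨W, hW, hWn⟩ := h.exists_correction hU_bdd h1 hβ
  have hne : Nonempty {u : Helmholtz.H10 U // u ≠ 0} := by
    obtain ⟨u, hu, hu0⟩ := (Submodule.ne_bot_iff _).1 (Helmholtz.H10_ne_bot hU_ne)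
    exact ⟨⟨⟨u, hu⟩, fun h0 => hu0 (congrArg Subtype.val h0)⟩⟩
  -- By Cauchy–Schwarz the quotients are bounded, so that the real suprema dominate each of their
  -- members.
  have hle : ∀ u v : Helmholtz.H1 U, ‖Helmholtz.helmholtzForm U a κ u v‖ /
      (Helmholtz.energyNorm U a κ u * Helmholtz.energyNorm U a κ v) ≤ 1 := fun u v => by
    rw [h.energyNorm_eq, h.energyNorm_eq]
    exact div_le_one_of_le₀ (h.norm_helmholtzForm_le u v) (by positivity)
  refine ⟨hβ, le_ciInf fun u => ?_, le_ciInf fun v => ?_, fun t => ?_, ?_⟩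
  · obtain ⟨v, hv, hv0, huv⟩ := h.exists_infSupConst_le hU_bdd hβ u.1.2
      fun h0 => u.2 (Subtype.ext h0)
    exact le_ciSup_of_le ⟨1, by rintro _ ⟨v, rfl⟩; exact hle _ _⟩
      ⟨⟨v, hv⟩, fun h0 => hv0 (congrArg Subtype.val h0)⟩ huv
  · obtain ⟨u, hu, hu0, huv⟩ := h.exists_infSupConst_le hU_bdd hβ v.1.2
      fun h0 => v.2 (Subtype.ext h0)
    rw [h.norm_helmholtzForm_comm, mul_comm] at huv
    exact le_ciSup_of_le ⟨1, by rintro _ ⟨u, rfl⟩; exact hle _ _⟩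
      ⟨⟨u, hu⟩, fun h0 => hu0 (congrArg Subtype.val h0)⟩ huv
  · exact ⟨W t, (hW t _).2 rfl, fun w hw => (hW t w).1 hw⟩
  -- For `t ∈ H¹₀(U)` the correction is `-t`, so `id + W` vanishes there and descends to a
  -- continuous map on traces.
  · have hker : Helmholtz.H10 U ≤ (ContinuousLinearMap.id ℂ (Helmholtz.H1 U) + W).ker := by
      intro t ht
      have h2 : Helmholtz.IsCorrection U a κ t (-t) := by
        refine ⟨neg_mem ht, fun v _ => ?_⟩
        rw [h.helmholtzForm_eq, h.helmholtzForm_eq, map_neg, map_neg, inner_neg_right]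
      change t + W t = 0
      rw [← (hW t _).1 h2, add_neg_cancel]
    refine ⟨(Helmholtz.H10 U).liftQL _ hker, ?_, fun E' hE' => ?_, ?_⟩
    · rintro _ t rfl
      exact ⟨W t, (hW t _).2 rfl, rfl⟩
    · funext τ
      obtain ⟨t, rfl⟩ := (Helmholtz.H10 U).mkQ_surjective τ
      obtain ⟨t₀, ht₀, hE⟩ := hE' _ t rfl
      exact hE.trans (by rw [(hW t t₀).1 ht₀]; rfl)
    · rintro _ t rfl
      change Helmholtz.energyNorm U a κ (t + W t) ≤ _
      have h3 : Helmholtz.energyNorm U a κ (t + W t)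
          ≤ Helmholtz.energyNorm U a κ t + Helmholtz.energyNorm U a κ (W t) := by
        simp only [h.energyNorm_eq, map_add]
        exact norm_add_le _ _
      linarith [hWn t]
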